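/- **Setting.** Let $\mathcal X\subseteq\mathbb R^d$ be a set of queries, $\mathcal P$ a class of probability distributions on $\mathbb R^d$, and $x\mapsto P_x\in\mathcal P$ a measurable family of input distributions, $x\in\mathcal X$. Let $\mathcal H_k$ be a reproducing kernel Hilbert space (RKHS) of measurable functions on $\mathbb R^d$ with mean map $\psi:\mathcal P\to\mathcal H_k$, $\langle\psi_P,g\rangle=\mathbb E_P[g]$ for all $g\in\mathcal H_k$, and let $\hat k(P,Q)=L(\psi_P,\psi_Q)$ be a positive definite kernel on $\mathcal P$ with RKHS $\mathcal H_{\hat k}$, for some functional $L$ (for instance $\hat k(P,Q)=\exp(-\alpha\|\psi_P-\psi_Q\|^2)=\exp(-\alpha\,\mathrm{MMD}^2(P,Q))$). Assume that $(x,x')\mapsto\hat k(P_x,P_{x'})$ is measurable, that $\hat k(P_x,P_x)\le B$ for all $x\in\mathcal X$, and that $\hat k(P_x,P_x)\ge\kappa>0$ for at least one $x\in\mathcal X$ (for the exponential kernel, $B=\kappa=1$). Let $f\in\mathcal H_k$ be such that $\hat f(P):=\mathbb E_P[f]$ belongs to $\mathcal H_{\hat k}$ with $\|\hat f\|_{\hat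 k}\le b$. For $\sigma_E>0$ assume that for every $x\in\mathcal X$ the input-induced noise $f(u)-\mathbb E_{P_x}[f]$, $u\sim P_x$, is $\sigma_E$-sub-Gaussian, where $\xi$ is called $s$-sub-Gaussian if $\mathbb E[e^{\lambda\xi}]\le e^{\lambda^2s^2/2}$ for all $\lambda\in\mathbb R$. For a kernel $k'$ on $\mathcal X$, $\sigma^2>0$, queries $x_1,\dots,x_t$ and observations $\mathbf y_t=(y_1,\dots,y_t)^T$ put $\mathbf K_t=[k'(x_i,x_j)]_{i,j}$, $\mathbf k_t(x)=[k'(x,x_i)]_i$, $$\mu_t(x)=\mathbf k_t(x)^T(\mathbf K_t+\sigma^2\mathbf I)^{-1}\mathbf y_t,\qquad \sigma_t^2(x)=k'(x,x)-\mathbf k_t(x)^T(\mathbf K_t+\sigma^2\mathbf I)^{-1}\mathbf k_t(x).$$ The maximum information gain of $\hat k$ is $\hat\gamma_t=\sup\frac12\ln\det(\mathbf I+\sigma^{-2}\hat{\mathbf K}_t)$, the supremum over all families $x_1,\dots,x_t\in\mathcal X$ (repetitions allowed), with $\hat{\mathbf K}_t=[\hat k(P_{x_i},P_{x_j})]_{i,j}$.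 **Algorithm.** Fix a horizon $n\ge1$, $\delta>0$, $\varepsilon>0$, $e_\varepsilon\ge0$, and let $\sigma^2=1+\frac2n$ throughout. In round $t=1,\dots,n$ a query $x_t\in\mathcal X$ is selected from the information available so far; the input $u_t$ that is actually evaluated has conditional distribution $P_{x_t}$ given that information; and $y_t=f(u_t)+\zeta_t$ is observed, where the noise $\zeta_t$ is $\sigma_\zeta$-sub-Gaussian, $\sigma_\zeta>0$, conditionally on that information and $u_t$. In round $t$ a (random) approximation $\tilde k_t(x,x')$ of $\hat k(P_x,P_{x'})$ is used, whose entrywise error is at most $e_\varepsilon$ with probability at least $1-\varepsilon$: outside an event of probability at most $\varepsilon$, $|\hat k(P_x,P_{x'})-\tilde k_t(x,x')|\le e_\varepsilon$ for all $x,x'\in\mathcal X$. The query $x_t$ maximizes over $\mathcal X$ the acquisition function $\tilde\mu_{t-1}(x)+\beta_{t-1}\tilde\sigma_{t-1}(x)$, where $\tilde\mu_{t-1},\tilde\sigma_{t-1}$ are the posterior mean and standard deviation above for the kernel $\tilde k_t$ and the first $t-1$ queries and observations (with $\tilde\sigma_{t-1}(x):=0$ where $\tilde\sigma^2_{t-1}(x)<0$,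 and with $0$ in place of the inverse matrix if that matrix is singular), and $$\beta_m=b+\sqrt{\sigma_E^2+\sigma_\zeta^2}\,\sqrt{2(\hat\gamma_m+1-\ln\delta)}.$$ **Theorem.** There is a constant $C>0$ depending only on $b,\sigma_E,\sigma_\zeta,\kappa,B$ such that in every such setting, for all $n,\delta,\varepsilon,e_\varepsilon$, with probability at least $1-\delta-n\varepsilon$ the uncertain-inputs cumulative regret $\tilde R_n=\sum_{t=1}^n\big(\sup_{x\in\mathcal X}\mathbb E_{P_x}[f]-\mathbb E_{P_{x_t}}[f]\big)$ satisfies $$\tilde R_n\le C\Big(\sqrt{n\hat\gamma_n(\hat\gamma_n-\ln\delta)}+n^2\sqrt{(\hat\gamma_n-\ln\delta)\,e_\varepsilon}+n^3e_\varepsilon\Big).$$ -/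

import Mathlib

open MeasureTheory ProbabilityTheory
open scoped Matrix InnerProductSpace

/-- The Euclidean space `ℝᵈ`. -/
abbrev Euc (d : ℕ) : Type := EuclideanSpace ℝ (Fin d)

noncomputable section

/-! ### Kernels and mean maps -/

/-- The real-valued reproducing kernel `k(x, y)` of a reproducing kernel Hilbert space `H` of real
functions on `X`. -/
def reproducingKernel (H : Type*) {X : Type*} [NormedAddCommGroup H] [InnerProductSpace ℝ H]
    [CompleteSpace H] [RKHS ℝ H X ℝ] (x y : X) : ℝ :=
  RKHS.kernel H x y 1

/-- `ψ` is the mean map of the class `𝒬` of distributions into the reproducing kernel Hilbert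
space `H`: every `g ∈ H` is integrable under every `Q ∈ 𝒬`, and `⟪ψ Q, g⟫ = E_Q[g]`. -/
def IsMeanMap {E H : Type*} [MeasurableSpace E] [NormedAddCommGroup H] [InnerProductSpace ℝ H]
    [RKHS ℝ H E ℝ] (𝒬 : Set (Measure E)) (ψ : 𝒬 → H) : Prop :=
  ∀ (Q : 𝒬) (g : H), Integrable (fun u => g u) Q.1 ∧ ⟪ψ Q, g⟫_ℝ = ∫ u, g u ∂Q.1

/-- The kernel `(x, y) ↦ k̂(P_x, P_y) = L (ψ_{P_x}) (ψ_{P_y})` between uncertain inputs.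
For `L u v = exp (-α * ‖u - v‖ ^ 2)` this is `exp (-α MMD²(P_x, P_y))`. -/
def inputKernel {E H X : Type*} [MeasurableSpace E] [MeasurableSpace X] {𝒬 : Set (Measure E)}
    (L : H → H → ℝ) (ψ : 𝒬 → H) (P : Kernel X E) (hP : ∀ x, P x ∈ 𝒬) (x y : X) : ℝ :=
  L (ψ ⟨P x, hP x⟩) (ψ ⟨P y, hP y⟩)

/-! ### Gaussian process posterior, information gain, acquisition function -/

section GP

variable {X : Type*}

/-- The kernel matrix `[k(z_i, z_j)]`. -/
def gramMatrix (k : X → X → ℝ) {t : ℕ} (z : Fin t → X) : Matrix (Fin t) (Fin t) ℝ :=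
  Matrix.of fun i j => k (z i) (z j)

/-- The vector `[k(x, z_1), …, k(x, z_t)]`. -/
def kernelVec (k : X → X → ℝ) {t : ℕ} (z : Fin t → X) (x : X) : Fin t → ℝ :=
  fun i => k x (z i)

/-- Posterior mean `k_t(x)ᵀ (K_t + s I)⁻¹ y_t` with noise parameter `s = σ²`. -/
def posteriorMean (k : X → X → ℝ) (s : ℝ) {t : ℕ} (z : Fin t → X) (y : Fin t → ℝ) (x : X) : ℝ :=
  kernelVec k z x ⬝ᵥ ((gramMatrix k z + s • (1 : Matrix (Fin t) (Fin t) ℝ))⁻¹ *ᵥ y)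

/-- Posterior variance `k(x, x) - k_t(x)ᵀ (K_t + s I)⁻¹ k_t(x)` with noise parameter `s = σ²`. -/
def posteriorVar (k : X → X → ℝ) (s : ℝ) {t : ℕ} (z : Fin t → X) (x : X) : ℝ :=
  k x x - kernelVec k z x ⬝ᵥ
    ((gramMatrix k z + s • (1 : Matrix (Fin t) (Fin t) ℝ))⁻¹ *ᵥ kernelVec k z x)

/-- Information gain `(1/2) ln det (I + s⁻¹ K_t)`. -/
def infoGain (k : X → X → ℝ) (s : ℝ) {t : ℕ} (z : Fin t → X) : ℝ :=
  1 / 2 * Real.log (1 + s⁻¹ • gramMatrix k z).det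

/-- Maximum information gain over all families of `t` inputs (repetitions allowed). -/
def maxInfoGain (k : X → X → ℝ) (s : ℝ) (t : ℕ) : ℝ :=
  ⨆ z : Fin t → X, infoGain k s z

/-- The exploration parameter `β = b + √(σE² + σζ²) √(2 (γ + 1 - ln δ))`. -/
def ucbBeta (b σE σζ γ δ : ℝ) : ℝ :=
  b + √(σE ^ 2 + σζ ^ 2) * √(2 * (γ + 1 - Real.log δ))

/-- The upper confidence bound acquisition function `μ_t(x) + β σ_t(x)`. -/
def ucbAcquisition (k : X → X → ℝ) (s β : ℝ) {t : ℕ} (z : Fin t → X) (y : Fin t → ℝ) (x : X) : ℝ :=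
  posteriorMean k s z y x + β * √(posteriorVar k s z x)

end GP

/-! ### The optimization process -/

section Queries

variable {Ω E X : Type*} [mΩ : MeasurableSpace Ω] [mE : MeasurableSpace E] [MeasurableSpace X]

/-- `n` rounds of querying with uncertain inputs. In round `t` (counted from `0`) the query `x t` is
chosen from the information `ℱ t`; the input actually evaluated, `u t`, has conditional
distribution `P_{x t}` given `ℱ t`; the observation noise `ζ t` is `σζ`-sub-Gaussian conditionally
on `ℱ t` and `u t`. -/
structure IsUncertainInputProcess (μ : Measure Ω) (ℱ : Filtration ℕ mΩ) (n : ℕ) (P : Kernel X E)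
    (σζ : ℝ) (x : ℕ → Ω → X) (u : ℕ → Ω → E) (ζ : ℕ → Ω → ℝ) : Prop where
  measurable_query : ∀ t < n, Measurable[ℱ t] (x t)
  measurable_input : ∀ t < n, Measurable[ℱ (t + 1)] (u t)
  measurable_noise : ∀ t < n, Measurable[ℱ (t + 1)] (ζ t)
  input_law : ∀ t < n, ∀ s : Set E, MeasurableSet s →
    μ[(u t ⁻¹' s).indicator (fun _ => (1 : ℝ)) | ℱ t] =ᵐ[μ] fun ω => (P (x t ω)).real s
  noise_integrable : ∀ t < n, ∀ l : ℝ, Integrable (fun ω => Real.exp (l * ζ t ω)) μ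
  noise_subGaussian : ∀ t < n, ∀ l : ℝ,
    μ[fun ω => Real.exp (l * ζ t ω) | ℱ t ⊔ mE.comap (u t)] ≤ᵐ[μ]
      fun _ => Real.exp (l ^ 2 * σζ ^ 2 / 2)

/-- For every uncertain input `x`, the input-induced noise `f(u) - E_{P_x}[f]` with `u ∼ P_x` is
`σE`-sub-Gaussian. -/
def InputNoiseSubGaussian (P : Kernel X E) (f : E → ℝ) (σE : ℝ) : Prop :=
  ∀ (x : X) (l : ℝ), Integrable (fun u => Real.exp (l * (f u - ∫ v, f v ∂(P x)))) (P x) ∧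
    ∫ u, Real.exp (l * (f u - ∫ v, f v ∂(P x))) ∂(P x) ≤ Real.exp (l ^ 2 * σE ^ 2 / 2)

/-- In each of the `n` rounds the (random) kernel estimate `ktil t` of that round is within `e` of
the exact kernel `khat` in every entry, except on an event of probability at most `ε`. -/
def IsKernelEstimate (μ : Measure Ω) (n : ℕ) (khat : X → X → ℝ) (ktil : ℕ → Ω → X → X → ℝ)
    (e ε : ℝ) : Prop :=
  ∀ t < n, μ {ω | ¬ ∀ x y, |khat x y - ktil t ω x y| ≤ e} ≤ ENNReal.ofReal ε

/-- Almost surely, in every round `t < n` the query `x t` maximizes the acquisition function that is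
computed from the kernel estimate `ktil t` and the first `t` queries and observations
`y i = f (u i) + ζ i`, with noise parameter `s` and exploration parameter `β t`. -/
def IsInexactGPUCB (μ : Measure Ω) (n : ℕ) (ktil : ℕ → Ω → X → X → ℝ) (s : ℝ) (β : ℕ → ℝ)
    (f : E → ℝ) (x : ℕ → Ω → X) (u : ℕ → Ω → E) (ζ : ℕ → Ω → ℝ) : Prop :=
  ∀ᵐ ω ∂μ, ∀ t < n, ∀ x' : X,
    ucbAcquisition (ktil t ω) s (β t) (fun i : Fin t => x i ω)
        (fun i : Fin t => f (u i ω) + ζ i ω) x' ≤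
      ucbAcquisition (ktil t ω) s (β t) (fun i : Fin t => x i ω)
        (fun i : Fin t => f (u i ω) + ζ i ω) (x t ω)

/-- The uncertain-inputs cumulative regret
`∑_{t < n} (sup_x E_{P_x}[f] - E_{P_{x t}}[f])` of a sequence of queries. -/
def cumulativeRegret (P : Kernel X E) (f : E → ℝ) (n : ℕ) (x : ℕ → X) : ℝ :=
  ∑ t ∈ Finset.range n, ((⨆ z : X, ∫ v, f v ∂(P z)) - ∫ v, f v ∂(P (x t)))

end Queries

end

/-! Because `fhat` lies in the space with kernel k̂, each observation is `⟪φ x, fhat⟫` plus noise,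
where `φ x` is the kernel feature of P_x. The noise (input-induced plus observational) is
conditionally sub-Gaussian with variance proxy σE² + σζ². The problem is therefore GP-UCB on
distributions, run with a perturbed kernel.

Concentration: with v the noise divided by √(σE² + σζ²), det(K + sI)^(-1/2) exp(vᵀ(I - (K + sI)⁻¹)v
/ 2) is the likelihood ratio of N(0, K + sI) and N(0, I) at v. By the chain rule it is a product of
one-step ratios of N(a, 1 + w) and N(0, 1) with predictable a and w. Each of these is a Gaussian
mixture of tilts exp(hξ - h²/2), so the product is a nonnegative supermartingale. Ville's inequality
bounds `selfNormSq` in all rounds at once (`measure_exists_selfNormSq_gt_le`), and Cauchy–Schwarz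
turns this into a confidence band of width β times the posterior deviation
(`abs_sub_posteriorMean_le`). In s = 1 + 2/n, the excess over 1 makes w positive and controls the
Euclidean norm of the noise, while t ln s ≤ 2 costs only the additive 1 inside β.

Perturbation: if n²e ≤ 1/2, the estimated matrix stays coercive; the posterior mean moves by O(n²eβ)
and the variance by O(n²e), hence the acquisition function by O(n√e β). Optimism bounds the regret
of one round by 2β times the posterior deviation plus this error
(`inner_sub_inner_le_of_ucb_maximizer`). Summation by Cauchy–Schwarz, with the sum of variances
bounded by the information gain, gives the first two terms. If n²e > 1/2, the trivial bound O(n) is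
below the third term. Finally κ keeps γ̂_n away from 0, so β = O(√(γ̂_n - ln δ)). -/

/-! ### Matrices with coercive quadratic form -/

section Coercive

variable {ι : Type*} [Fintype ι]

theorem dotProduct_sq_le (v w : ι → ℝ) : (v ⬝ᵥ w) ^ 2 ≤ (v ⬝ᵥ v) * (w ⬝ᵥ w) := by
  have h := Finset.sum_mul_sq_le_sq_mul_sq Finset.univ v w
  simpa [dotProduct, sq] using h

theorem dotProduct_self_nonneg_real (v : ι → ℝ) : 0 ≤ v ⬝ᵥ v :=
  Finset.sum_nonneg fun i _ => mul_self_nonneg (v i)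

theorem sum_abs_sq_le (v : ι → ℝ) : (∑ i, |v i|) ^ 2 ≤ Fintype.card ι * (v ⬝ᵥ v) := by
  have h := sq_sum_le_card_mul_sum_sq (s := (Finset.univ : Finset ι)) (f := fun i => |v i|)
  simpa [dotProduct, sq] using h

theorem abs_dotProduct_le_of_abs_le {e : ℝ} {u : ι → ℝ} (hu : ∀ i, |u i| ≤ e) (v : ι → ℝ) :
    |u ⬝ᵥ v| ≤ e * ∑ i, |v i| := by
  rw [Finset.mul_sum]
  refine (Finset.abs_sum_le_sum_abs _ _).trans (Finset.sum_le_sum fun i _ => ?_)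
  rw [abs_mul]
  exact mul_le_mul_of_nonneg_right (hu i) (abs_nonneg _)

theorem abs_dotProduct_mulVec_le {e : ℝ} {E : Matrix ι ι ℝ} (hE : ∀ i j, |E i j| ≤ e)
    (v w : ι → ℝ) : |v ⬝ᵥ (E *ᵥ w)| ≤ e * (∑ i, |v i|) * ∑ i, |w i| := by
  have h : ∀ i, |(E *ᵥ w) i| ≤ e * ∑ i, |w i| := fun i =>
    abs_dotProduct_le_of_abs_le (hE i) w
  rw [dotProduct_comm]
  refine (abs_dotProduct_le_of_abs_le h v).trans (le_of_eq (by ring))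

theorem dotProduct_mulVec_comm_of_symm {A : Matrix ι ι ℝ} (hA : Aᵀ = A) (v w : ι → ℝ) :
    v ⬝ᵥ (A *ᵥ w) = (A *ᵥ v) ⬝ᵥ w := by
  rw [Matrix.dotProduct_mulVec, ← Matrix.mulVec_transpose, hA]

variable [DecidableEq ι] {A : Matrix ι ι ℝ} {s : ℝ}

/-- Positivity is expressed through the quadratic form alone, because the matrix of an estimated
kernel need not be symmetric. -/
theorem isUnit_det_of_coercive (hs : 0 < s) (hA : ∀ v, s * (v ⬝ᵥ v) ≤ v ⬝ᵥ (A *ᵥ v)) :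
    IsUnit A.det := by
  rw [isUnit_iff_ne_zero]
  intro h
  obtain ⟨v, hv, hv0⟩ := Matrix.exists_mulVec_eq_zero_iff.mpr h
  have h1 := hA v
  rw [hv0, dotProduct_zero] at h1
  have h2 : v ⬝ᵥ v = 0 := by nlinarith [dotProduct_self_nonneg_real v]
  exact hv (dotProduct_self_eq_zero.mp h2)

theorem mulVec_inv_mulVec (hA : IsUnit A.det) (r : ι → ℝ) : A *ᵥ (A⁻¹ *ᵥ r) = r := by
  rw [Matrix.mulVec_mulVec, Matrix.mul_nonsing_inv _ hA, Matrix.one_mulVec]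

theorem inv_mulVec_eq_of_mulVec_eq (hA : IsUnit A.det) {v r : ι → ℝ} (h : A *ᵥ v = r) :
    A⁻¹ *ᵥ r = v := by
  rw [← h, Matrix.mulVec_mulVec, Matrix.nonsing_inv_mul _ hA, Matrix.one_mulVec]

/-- For w = A⁻¹r, s|w|² ≤ wᵀAw = wᵀr ≤ |w||r|; symmetry plays no role. -/
theorem sq_mul_dotProduct_inv_mulVec_le (hs : 0 < s)
    (hA : ∀ v, s * (v ⬝ᵥ v) ≤ v ⬝ᵥ (A *ᵥ v)) (r : ι → ℝ) :
    s ^ 2 * ((A⁻¹ *ᵥ r) ⬝ᵥ (A⁻¹ *ᵥ r)) ≤ r ⬝ᵥ r := by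
  set w := A⁻¹ *ᵥ r with hw
  have h1 := hA w
  rw [hw, mulVec_inv_mulVec (isUnit_det_of_coercive hs hA), ← hw] at h1
  have h2 := dotProduct_sq_le w r
  have h0 := dotProduct_self_nonneg_real w
  rcases h0.eq_or_lt with h | h
  · rw [← h, mul_zero]
    exact dotProduct_self_nonneg_real r
  · have h3 : (s * (w ⬝ᵥ w)) ^ 2 ≤ (w ⬝ᵥ w) * (r ⬝ᵥ r) :=
      (pow_le_pow_left₀ (by positivity) h1 2).trans h2
    have h4 : (w ⬝ᵥ w) * (s ^ 2 * (w ⬝ᵥ w)) ≤ (w ⬝ᵥ w) * (r ⬝ᵥ r) := by linarith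
    exact le_of_mul_le_mul_left h4 h

theorem mul_dotProduct_inv_mulVec_le (hs : 0 < s)
    (hA : ∀ v, s * (v ⬝ᵥ v) ≤ v ⬝ᵥ (A *ᵥ v)) (r : ι → ℝ) :
    s * (r ⬝ᵥ (A⁻¹ *ᵥ r)) ≤ r ⬝ᵥ r := by
  have h1 := sq_mul_dotProduct_inv_mulVec_le hs hA r
  have h2 := dotProduct_sq_le r (A⁻¹ *ᵥ r)
  have h3 := dotProduct_self_nonneg_real r
  have h4 : (s * (r ⬝ᵥ (A⁻¹ *ᵥ r))) ^ 2 ≤ (r ⬝ᵥ r) ^ 2 := by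
    calc (s * (r ⬝ᵥ (A⁻¹ *ᵥ r))) ^ 2 = s ^ 2 * (r ⬝ᵥ (A⁻¹ *ᵥ r)) ^ 2 := by ring
      _ ≤ s ^ 2 * ((r ⬝ᵥ r) * ((A⁻¹ *ᵥ r) ⬝ᵥ (A⁻¹ *ᵥ r))) := by gcongr
      _ = (r ⬝ᵥ r) * (s ^ 2 * ((A⁻¹ *ᵥ r) ⬝ᵥ (A⁻¹ *ᵥ r))) := by ring
      _ ≤ (r ⬝ᵥ r) * (r ⬝ᵥ r) := by gcongr
      _ = _ := by ring
  exact abs_le_of_sq_le_sq' h4 h3 |>.2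

theorem dotProduct_mulVec_sq_le (hA : Aᵀ = A) (h0 : ∀ v, 0 ≤ v ⬝ᵥ (A *ᵥ v)) (v w : ι → ℝ) :
    (v ⬝ᵥ (A *ᵥ w)) ^ 2 ≤ (v ⬝ᵥ (A *ᵥ v)) * (w ⬝ᵥ (A *ᵥ w)) := by
  have h := LinearMap.BilinForm.apply_mul_apply_le_of_forall_zero_le (Matrix.toBilin' A)
    (fun v => by rw [Matrix.toBilin'_apply']; exact h0 v) v w
  simp only [Matrix.toBilin'_apply'] at h
  have h2 : w ⬝ᵥ (A *ᵥ v) = v ⬝ᵥ (A *ᵥ w) := by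
    rw [dotProduct_mulVec_comm_of_symm hA, dotProduct_comm]
  rw [h2] at h
  rw [sq]
  exact h

end Coercive

/-! ### Posterior mean and variance in feature space, confidence band -/

noncomputable section

section Posterior

variable {X V : Type*} [NormedAddCommGroup V] [InnerProductSpace ℝ V] {k : X → X → ℝ} {φ : X → V}
  {t : ℕ} {s : ℝ}

/-- The regularized kernel matrix `K_t + s I`. -/
def regGram (k : X → X → ℝ) (s : ℝ) {t : ℕ} (z : Fin t → X) : Matrix (Fin t) (Fin t) ℝ :=
  gramMatrix k z + s • (1 : Matrix (Fin t) (Fin t) ℝ)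

theorem regGram_mulVec (k : X → X → ℝ) (s : ℝ) (z : Fin t → X) (v : Fin t → ℝ) :
    regGram k s z *ᵥ v = gramMatrix k z *ᵥ v + s • v := by
  rw [regGram, Matrix.add_mulVec, Matrix.smul_mulVec, Matrix.one_mulVec]

theorem regGram_transpose (hk : ∀ x y, k x y = ⟪φ x, φ y⟫_ℝ) (z : Fin t → X) :
    (regGram k s z)ᵀ = regGram k s z := by
  ext i j
  simp only [regGram, gramMatrix, Matrix.transpose_apply, Matrix.add_apply, Matrix.of_apply,
    Matrix.smul_apply, hk, real_inner_comm, Matrix.one_apply, eq_comm]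

theorem regGram_inv_transpose (hk : ∀ x y, k x y = ⟪φ x, φ y⟫_ℝ) (z : Fin t → X) :
    ((regGram k s z)⁻¹)ᵀ = (regGram k s z)⁻¹ := by
  rw [Matrix.transpose_nonsing_inv, regGram_transpose hk]

theorem dotProduct_gramMatrix_mulVec (hk : ∀ x y, k x y = ⟪φ x, φ y⟫_ℝ) (z : Fin t → X)
    (v : Fin t → ℝ) : v ⬝ᵥ (gramMatrix k z *ᵥ v) = ‖∑ i, v i • φ (z i)‖ ^ 2 := by
  rw [← real_inner_self_eq_norm_sq, sum_inner]
  refine Finset.sum_congr rfl fun i _ => ?_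
  rw [inner_sum, Matrix.mulVec, dotProduct, Finset.mul_sum]
  refine Finset.sum_congr rfl fun j _ => ?_
  rw [real_inner_smul_left, real_inner_smul_right, gramMatrix, Matrix.of_apply, hk]
  ring

theorem regGram_coercive (hk : ∀ x y, k x y = ⟪φ x, φ y⟫_ℝ) (z : Fin t → X)
    (v : Fin t → ℝ) : s * (v ⬝ᵥ v) ≤ v ⬝ᵥ (regGram k s z *ᵥ v) := by
  rw [regGram_mulVec, dotProduct_add, dotProduct_gramMatrix_mulVec hk, dotProduct_smul, smul_eq_mul]
  linarith [sq_nonneg ‖∑ i, v i • φ (z i)‖]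

theorem isUnit_det_regGram (hk : ∀ x y, k x y = ⟪φ x, φ y⟫_ℝ) (hs : 0 < s) (z : Fin t → X) :
    IsUnit (regGram k s z).det :=
  isUnit_det_of_coercive hs (regGram_coercive hk z)

/-- The weights c = (K + sI)⁻¹κ are those of the ridge regression of `φ x` on the features `φ (z
i)`. Expanding the square and using cᵀKc = cᵀκ - s|c|² gives the identity; the posterior variance
thus dominates the squared residual. -/
theorem norm_sub_sum_sq (hk : ∀ x y, k x y = ⟪φ x, φ y⟫_ℝ) (hs : 0 < s) (z : Fin t → X) (x : X) :
    ‖φ x - ∑ i, ((regGram k s z)⁻¹ *ᵥ kernelVec k z x) i • φ (z i)‖ ^ 2 =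
      posteriorVar k s z x - s * (((regGram k s z)⁻¹ *ᵥ kernelVec k z x) ⬝ᵥ
        ((regGram k s z)⁻¹ *ᵥ kernelVec k z x)) := by
  set c := (regGram k s z)⁻¹ *ᵥ kernelVec k z x with hc
  have h1 : regGram k s z *ᵥ c = kernelVec k z x := mulVec_inv_mulVec (isUnit_det_regGram hk hs z) _
  have h2 := dotProduct_gramMatrix_mulVec hk z c
  have h3 : c ⬝ᵥ (regGram k s z *ᵥ c) = c ⬝ᵥ (gramMatrix k z *ᵥ c) + s * (c ⬝ᵥ c) := by
    rw [regGram_mulVec, dotProduct_add, dotProduct_smul, smul_eq_mul]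
  have h4 : ⟪φ x, ∑ i, c i • φ (z i)⟫_ℝ = c ⬝ᵥ kernelVec k z x := by
    rw [inner_sum]
    refine Finset.sum_congr rfl fun i _ => ?_
    rw [real_inner_smul_right, kernelVec, hk]
  rw [norm_sub_sq_real, h4, ← h2, ← real_inner_self_eq_norm_sq, ← hk]
  have h5 : posteriorVar k s z x = k x x - kernelVec k z x ⬝ᵥ c := rfl
  rw [h5, dotProduct_comm (kernelVec k z x) c]
  rw [h1] at h3
  linarith

theorem posteriorVar_nonneg (hk : ∀ x y, k x y = ⟪φ x, φ y⟫_ℝ) (hs : 0 < s) (z : Fin t → X)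
    (x : X) : 0 ≤ posteriorVar k s z x := by
  have h := norm_sub_sum_sq hk hs z x
  have h2 := dotProduct_self_nonneg_real ((regGram k s z)⁻¹ *ᵥ kernelVec k z x)
  nlinarith [sq_nonneg ‖φ x - ∑ i, ((regGram k s z)⁻¹ *ᵥ kernelVec k z x) i • φ (z i)‖]

theorem posteriorVar_le (hk : ∀ x y, k x y = ⟪φ x, φ y⟫_ℝ) (hs : 0 < s) (z : Fin t → X)
    (x : X) : posteriorVar k s z x ≤ k x x := by
  set c := (regGram k s z)⁻¹ *ᵥ kernelVec k z x with hc
  have h1 : regGram k s z *ᵥ c = kernelVec k z x := mulVec_inv_mulVec (isUnit_det_regGram hk hs z) _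
  have h2 := regGram_coercive (s := s) hk z c
  have h5 : posteriorVar k s z x = k x x - kernelVec k z x ⬝ᵥ c := rfl
  rw [h1, dotProduct_comm c (kernelVec k z x)] at h2
  rw [h5]
  linarith [mul_nonneg hs.le (dotProduct_self_nonneg_real c)]

/-- The self-normalized square `vᵀ (I - (K_t + s I)⁻¹) v`. -/
def selfNormSq (k : X → X → ℝ) (s : ℝ) (z : Fin t → X) (v : Fin t → ℝ) : ℝ :=
  v ⬝ᵥ v - v ⬝ᵥ ((regGram k s z)⁻¹ *ᵥ v)

theorem selfNormSq_eq (z : Fin t → X) (v : Fin t → ℝ) :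
    selfNormSq k s z v = v ⬝ᵥ ((1 - (regGram k s z)⁻¹) *ᵥ v) := by
  rw [Matrix.sub_mulVec, Matrix.one_mulVec, dotProduct_sub, selfNormSq]

theorem sub_one_mul_dotProduct_le_selfNormSq (hk : ∀ x y, k x y = ⟪φ x, φ y⟫_ℝ) (hs : 0 < s)
    (z : Fin t → X) (v : Fin t → ℝ) : (s - 1) * (v ⬝ᵥ v) ≤ s * selfNormSq k s z v := by
  have h := mul_dotProduct_inv_mulVec_le hs (regGram_coercive hk z) v
  rw [selfNormSq]
  linarith

theorem selfNormSq_nonneg (hk : ∀ x y, k x y = ⟪φ x, φ y⟫_ℝ) (hs : 1 ≤ s)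
    (z : Fin t → X) (v : Fin t → ℝ) : 0 ≤ selfNormSq k s z v := by
  have h := sub_one_mul_dotProduct_le_selfNormSq hk (by linarith : 0 < s) z v
  have h2 := mul_nonneg (sub_nonneg.mpr hs) (dotProduct_self_nonneg_real v)
  exact nonneg_of_mul_nonneg_right (h2.trans h) (by linarith)

/-- The posterior mean of pure noise is controlled by its self-normalized square. -/
theorem posteriorMean_sq_le (hk : ∀ x y, k x y = ⟪φ x, φ y⟫_ℝ) (hs : 1 < s)
    (z : Fin t → X) (v : Fin t → ℝ) (x : X) :
    posteriorMean k s z v x ^ 2 ≤ posteriorVar k s z x * selfNormSq k s z v := by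
  have hs0 : 0 < s := by linarith
  have hη : 0 < s - 1 := by linarith
  set κ := kernelVec k z x with hκ
  set A := regGram k s z with hA
  set D := regGram k (s - 1) z with hD
  set α := A⁻¹ *ᵥ κ with hα
  set β := D⁻¹ *ᵥ κ with hβ
  have hAD : ∀ w, A *ᵥ w = D *ᵥ w + w := fun w => by
    rw [hA, hD, regGram_mulVec, regGram_mulVec, sub_smul, one_smul]; abel
  have hAu : IsUnit A.det := isUnit_det_regGram hk hs0 z
  have hDu : IsUnit D.det := isUnit_det_regGram hk hη z
  have hAα : A *ᵥ α = κ := mulVec_inv_mulVec hAu κ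
  have hDβ : D *ᵥ β = κ := mulVec_inv_mulVec hDu κ
  -- As D = A - 1, the equation Dβ = κ reads Aβ = κ + β. So α is the image of β under N = 1 - A⁻¹,
  -- and Cauchy–Schwarz for the form N separates the noise from the query. Invertibility of D is
  -- where s > 1 enters.
  have hNβ : (1 - A⁻¹) *ᵥ β = α := by
    rw [Matrix.sub_mulVec, Matrix.one_mulVec]
    have h1 : A⁻¹ *ᵥ (κ + β) = β := inv_mulVec_eq_of_mulVec_eq hAu (by rw [hAD, hDβ])
    rw [Matrix.mulVec_add] at h1
    rw [hα, sub_eq_iff_eq_add]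
    exact h1.symm
  have hNsymm : (1 - A⁻¹)ᵀ = 1 - A⁻¹ := by
    rw [Matrix.transpose_sub, Matrix.transpose_one, hA, regGram_inv_transpose hk]
  have hN0 : ∀ w, 0 ≤ w ⬝ᵥ ((1 - A⁻¹) *ᵥ w) := fun w => by
    rw [hA, ← selfNormSq_eq]; exact selfNormSq_nonneg hk hs.le z w
  have hcs := dotProduct_mulVec_sq_le hNsymm hN0 β v
  rw [dotProduct_mulVec_comm_of_symm hNsymm β v, hNβ] at hcs
  have hmean : posteriorMean k s z v x = α ⬝ᵥ v := by
    have : posteriorMean k s z v x = κ ⬝ᵥ (A⁻¹ *ᵥ v) := rfl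
    rw [this, dotProduct_mulVec_comm_of_symm (by rw [hA, regGram_inv_transpose hk])]
  rw [hmean]
  rw [hA, ← selfNormSq_eq] at hcs
  refine hcs.trans (mul_le_mul_of_nonneg_right ?_ (selfNormSq_nonneg hk hs.le z v))
  have hDsymm : Dᵀ = D := regGram_transpose hk z
  -- The remaining factor βᵀα = κᵀβ - κᵀα is at most the posterior variance, because κᵀβ ≤ k(x, x):
  -- the variance with noise parameter s - 1 is nonnegative.
  have h1 : κ ⬝ᵥ β = κ ⬝ᵥ α + β ⬝ᵥ α := by
    calc κ ⬝ᵥ β = β ⬝ᵥ (A *ᵥ α) := by rw [hAα, dotProduct_comm]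
      _ = β ⬝ᵥ (D *ᵥ α) + β ⬝ᵥ α := by rw [hAD, dotProduct_add]
      _ = _ := by rw [dotProduct_mulVec_comm_of_symm hDsymm, hDβ]
  have h2 : posteriorVar k (s - 1) z x = k x x - κ ⬝ᵥ β := rfl
  have h3 : posteriorVar k s z x = k x x - κ ⬝ᵥ α := rfl
  have h4 := posteriorVar_nonneg hk hη z x
  rw [h3]
  linarith

theorem posteriorMean_add (z : Fin t → X) (v w : Fin t → ℝ) (x : X) :
    posteriorMean k s z (v + w) x = posteriorMean k s z v x + posteriorMean k s z w x := by
  rw [posteriorMean, Matrix.mulVec_add, dotProduct_add]; rfl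

/-- Confidence bound for the posterior mean of noisy observations of `⟪φ x, g⟫`. -/
theorem abs_sub_posteriorMean_le (hk : ∀ x y, k x y = ⟪φ x, φ y⟫_ℝ) (hs : 1 < s)
    (z : Fin t → X) (v : Fin t → ℝ) (x : X) {g : V} {b G : ℝ} (hg : ‖g‖ ≤ b)
    (hG : selfNormSq k s z v ≤ G) :
    |⟪φ x, g⟫_ℝ - posteriorMean k s z ((fun i => ⟪φ (z i), g⟫_ℝ) + v) x| ≤
      (b + √G) * √(posteriorVar k s z x) := by
  have hs0 : 0 < s := by linarith
  set c := (regGram k s z)⁻¹ *ᵥ kernelVec k z x with hc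
  -- On noiseless data the error is `g` tested against the ridge residual of `φ x`, whose norm is at
  -- most the posterior deviation.
  have h1 : posteriorMean k s z (fun i => ⟪φ (z i), g⟫_ℝ) x = ⟪∑ i, c i • φ (z i), g⟫_ℝ := by
    have : posteriorMean k s z (fun i => ⟪φ (z i), g⟫_ℝ) x =
      kernelVec k z x ⬝ᵥ ((regGram k s z)⁻¹ *ᵥ fun i => ⟪φ (z i), g⟫_ℝ) := rfl
    rw [this, dotProduct_mulVec_comm_of_symm (regGram_inv_transpose hk z), sum_inner]
    exact Finset.sum_congr rfl fun i _ => by rw [real_inner_smul_left]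
  have h2 : |⟪φ x - ∑ i, c i • φ (z i), g⟫_ℝ| ≤ b * √(posteriorVar k s z x) := by
    refine (abs_real_inner_le_norm _ _).trans ?_
    rw [mul_comm]
    refine mul_le_mul hg (Real.le_sqrt_of_sq_le ?_) (norm_nonneg _) ((norm_nonneg _).trans hg)
    rw [hc, norm_sub_sum_sq hk hs0]
    nlinarith [dotProduct_self_nonneg_real ((regGram k s z)⁻¹ *ᵥ kernelVec k z x)]
  have hv0 := posteriorVar_nonneg hk hs0 z x
  have h3 : |posteriorMean k s z v x| ≤ √G * √(posteriorVar k s z x) := by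
    rw [← Real.sqrt_sq_eq_abs, ← Real.sqrt_mul ((selfNormSq_nonneg hk hs.le z v).trans hG)]
    refine Real.sqrt_le_sqrt ((posteriorMean_sq_le hk hs z v x).trans ?_)
    rw [mul_comm]
    exact mul_le_mul_of_nonneg_right hG hv0
  rw [posteriorMean_add, h1, ← sub_sub, ← inner_sub_left, add_mul]
  exact (abs_sub _ _).trans (add_le_add h2 h3)

end Posterior

end

/-! ### Adding one query: recursions and information gain -/

noncomputable section

section Extension

variable {X V : Type*} [NormedAddCommGroup V] [InnerProductSpace ℝ V] {k : X → X → ℝ} {φ : X → V}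
  {t : ℕ} {s : ℝ}

theorem regGram_succ_mulVec_castSucc (hk : ∀ x y, k x y = ⟪φ x, φ y⟫_ℝ) (z : Fin (t + 1) → X)
    (v : Fin (t + 1) → ℝ) (i : Fin t) :
    (regGram k s z *ᵥ v) i.castSucc =
      (regGram k s (fun i => z i.castSucc) *ᵥ fun i => v i.castSucc) i
        + kernelVec k (fun i => z i.castSucc) (z (Fin.last t)) i * v (Fin.last t) := by
  rw [regGram_mulVec, regGram_mulVec]
  simp only [Pi.add_apply, Pi.smul_apply, Matrix.mulVec, dotProduct, gramMatrix, Matrix.of_apply,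
    Fin.sum_univ_castSucc, kernelVec]
  rw [hk (z i.castSucc) (z (Fin.last t)), real_inner_comm, ← hk]
  ring

theorem regGram_succ_mulVec_last (z : Fin (t + 1) → X) (v : Fin (t + 1) → ℝ) :
    (regGram k s z *ᵥ v) (Fin.last t) =
      kernelVec k (fun i => z i.castSucc) (z (Fin.last t)) ⬝ᵥ (fun i => v i.castSucc)
        + (k (z (Fin.last t)) (z (Fin.last t)) + s) * v (Fin.last t) := by
  rw [regGram_mulVec]
  simp only [Pi.add_apply, Pi.smul_apply, Matrix.mulVec, dotProduct, gramMatrix, Matrix.of_apply,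
    Fin.sum_univ_castSucc, kernelVec, smul_eq_mul]
  ring

/-- One step of the recursion for the quadratic form of the inverse kernel matrix. -/
theorem dotProduct_regGram_inv_succ (hk : ∀ x y, k x y = ⟪φ x, φ y⟫_ℝ) (hs : 0 < s)
    (z : Fin (t + 1) → X) (v : Fin (t + 1) → ℝ) :
    v ⬝ᵥ ((regGram k s z)⁻¹ *ᵥ v) =
      (fun i => v (Fin.castSucc i)) ⬝ᵥ
        ((regGram k s (fun i => z (Fin.castSucc i)))⁻¹ *ᵥ fun i => v (Fin.castSucc i))
      + (v (Fin.last t) - posteriorMean k s (fun i => z (Fin.castSucc i))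
          (fun i => v (Fin.castSucc i)) (z (Fin.last t))) ^ 2 /
        (s + posteriorVar k s (fun i => z (Fin.castSucc i)) (z (Fin.last t))) := by
  set z' : Fin t → X := fun i => z (Fin.castSucc i)
  set v' : Fin t → ℝ := fun i => v (Fin.castSucc i)
  set x := z (Fin.last t)
  set y := v (Fin.last t)
  set κ := kernelVec k z' x with hκ
  set A := regGram k s z' with hA
  have hAu : IsUnit A.det := isUnit_det_regGram hk hs z'
  have hsymm : (A⁻¹)ᵀ = A⁻¹ := regGram_inv_transpose hk z'
  have hm : posteriorMean k s z' v' x = κ ⬝ᵥ (A⁻¹ *ᵥ v') := rfl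
  have hvar : posteriorVar k s z' x = k x x - κ ⬝ᵥ (A⁻¹ *ᵥ κ) := rfl
  have hw : 0 < s + posteriorVar k s z' x := by linarith [posteriorVar_nonneg hk hs z' x]
  set w := s + posteriorVar k s z' x with hwdef
  set m := posteriorMean k s z' v' x
  set c := (y - m) / w with hc
  have hcw : c * w = y - m := div_mul_cancel₀ _ hw.ne'
  -- Block elimination: the last coordinate of the solution is the innovation y - m divided by the
  -- Schur complement w.
  have hsol : regGram k s z *ᵥ (Fin.snoc (A⁻¹ *ᵥ v' - c • (A⁻¹ *ᵥ κ)) c) = v := by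
    ext i
    refine Fin.lastCases ?_ (fun i => ?_) i
    · rw [regGram_succ_mulVec_last]
      simp only [Fin.snoc_castSucc, Fin.snoc_last]
      change κ ⬝ᵥ (A⁻¹ *ᵥ v' - c • (A⁻¹ *ᵥ κ)) + (k x x + s) * c = y
      rw [dotProduct_sub, dotProduct_smul, smul_eq_mul, ← hm]
      have : w = s + (k x x - κ ⬝ᵥ (A⁻¹ *ᵥ κ)) := by rw [hwdef, hvar]
      rw [this] at hcw
      linarith
    · rw [regGram_succ_mulVec_castSucc hk]
      simp only [Fin.snoc_castSucc, Fin.snoc_last]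
      change (A *ᵥ (A⁻¹ *ᵥ v' - c • (A⁻¹ *ᵥ κ))) i + κ i * c = v' i
      rw [Matrix.mulVec_sub, Matrix.mulVec_smul, mulVec_inv_mulVec hAu, mulVec_inv_mulVec hAu]
      simp only [Pi.sub_apply, Pi.smul_apply, smul_eq_mul]
      ring
  rw [inv_mulVec_eq_of_mulVec_eq (isUnit_det_regGram hk hs z) hsol]
  have h1 : v ⬝ᵥ (Fin.snoc (A⁻¹ *ᵥ v' - c • (A⁻¹ *ᵥ κ)) c) =
      v' ⬝ᵥ (A⁻¹ *ᵥ v' - c • (A⁻¹ *ᵥ κ)) + y * c := by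
    simp only [dotProduct, Fin.sum_univ_castSucc, Fin.snoc_castSucc, Fin.snoc_last]
    rfl
  rw [h1, dotProduct_sub, dotProduct_smul, smul_eq_mul,
    dotProduct_mulVec_comm_of_symm hsymm v' κ, dotProduct_comm _ κ, ← hm]
  rw [hc]
  ring

/-- The Schur complement of the old block in the bordered matrix is s plus the posterior variance at
the new query. -/
theorem det_regGram_succ (hk : ∀ x y, k x y = ⟪φ x, φ y⟫_ℝ) (hs : 0 < s) (z : Fin (t + 1) → X) :
    (regGram k s z).det = (regGram k s (fun i => z (Fin.castSucc i))).det *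
      (s + posteriorVar k s (fun i => z (Fin.castSucc i)) (z (Fin.last t))) := by
  set z' : Fin t → X := fun i => z (Fin.castSucc i) with hz'
  set x := z (Fin.last t) with hx
  set A := regGram k s z' with hA
  have hAu : IsUnit A.det := isUnit_det_regGram hk hs z'
  have hAi : Invertible A := A.invertibleOfIsUnitDet hAu
  have hblock : (regGram k s z).submatrix finSumFinEquiv finSumFinEquiv =
      Matrix.fromBlocks A (Matrix.replicateCol (Fin 1) (kernelVec k z' x))
        (Matrix.replicateRow (Fin 1) (kernelVec k z' x)) (Matrix.of fun _ _ => k x x + s) := by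
    have hl : ∀ j : Fin 1, Fin.natAdd t j = Fin.last t := fun j => by
      rw [Subsingleton.elim j 0]; rfl
    have hc : ∀ i : Fin t, Fin.castAdd 1 i = Fin.castSucc i := fun i => rfl
    ext (i | i) (j | j)
    · simp [regGram, gramMatrix, hA, hz', Matrix.one_apply, hc]
    · simp only [Matrix.submatrix_apply, finSumFinEquiv_apply_left, finSumFinEquiv_apply_right,
        Matrix.fromBlocks_apply₁₂, Matrix.replicateCol_apply, kernelVec, hl, hc, regGram,
        gramMatrix, Matrix.add_apply, Matrix.of_apply, Matrix.smul_apply, hx, hz',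
        Matrix.one_apply_ne (Fin.castSucc_lt_last i).ne, smul_zero, add_zero]
      rw [hk, real_inner_comm, ← hk]
    · simp only [Matrix.submatrix_apply, finSumFinEquiv_apply_left, finSumFinEquiv_apply_right,
        Matrix.fromBlocks_apply₂₁, Matrix.replicateRow_apply, kernelVec, hl, hc, regGram,
        gramMatrix, Matrix.add_apply, Matrix.of_apply, Matrix.smul_apply, hx, hz',
        Matrix.one_apply_ne (Fin.castSucc_lt_last j).ne', smul_zero, add_zero]
    · simp [regGram, gramMatrix, hx, hl]
  rw [← Matrix.det_submatrix_equiv_self finSumFinEquiv (regGram k s z), hblock,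
    Matrix.det_fromBlocks₁₁, Matrix.invOf_eq_nonsing_inv]
  congr 1
  rw [Matrix.det_unique, posteriorVar]
  have h1 : (Matrix.replicateRow (Fin 1) (kernelVec k z' x) * A⁻¹ *
      Matrix.replicateCol (Fin 1) (kernelVec k z' x)) default default =
      kernelVec k z' x ⬝ᵥ (A⁻¹ *ᵥ kernelVec k z' x) := by
    rw [Matrix.mul_assoc, Matrix.mul_apply]
    rfl
  rw [Matrix.sub_apply, h1, Matrix.of_apply]
  change _ = s + (k x x - kernelVec k z' x ⬝ᵥ (A⁻¹ *ᵥ kernelVec k z' x))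
  ring

theorem det_regGram_pos (hk : ∀ x y, k x y = ⟪φ x, φ y⟫_ℝ) (hs : 0 < s) :
    ∀ {t : ℕ} (z : Fin t → X), 0 < (regGram k s z).det
  | 0, z => by rw [Matrix.det_fin_zero]; exact one_pos
  | t + 1, z => by
    rw [det_regGram_succ hk hs]
    exact mul_pos (det_regGram_pos hk hs _)
      (by linarith [posteriorVar_nonneg hk hs (fun i => z (Fin.castSucc i)) (z (Fin.last t))])

theorem log_det_regGram (hk : ∀ x y, k x y = ⟪φ x, φ y⟫_ℝ) (hs : 0 < s) (z : Fin t → X) :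
    Real.log (regGram k s z).det = t * Real.log s + 2 * infoGain k s z := by
  have h : regGram k s z = s • ((1 : Matrix (Fin t) (Fin t) ℝ) + s⁻¹ • gramMatrix k z) := by
    rw [regGram, smul_add, smul_smul, mul_inv_cancel₀ hs.ne', one_smul, add_comm]
  have h0 := det_regGram_pos hk hs z
  rw [h, Matrix.det_smul, Fintype.card_fin] at h0 ⊢
  have h1 : 0 < ((1 : Matrix (Fin t) (Fin t) ℝ) + s⁻¹ • gramMatrix k z).det :=
    pos_of_mul_pos_right h0 (by positivity)
  rw [Real.log_mul (by positivity) h1.ne', Real.log_pow, infoGain]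
  ring

theorem infoGain_succ (hk : ∀ x y, k x y = ⟪φ x, φ y⟫_ℝ) (hs : 0 < s) (z : Fin (t + 1) → X) :
    infoGain k s z = infoGain k s (fun i => z (Fin.castSucc i)) + 1 / 2 *
      Real.log (1 + posteriorVar k s (fun i => z (Fin.castSucc i)) (z (Fin.last t)) / s) := by
  have h1 := log_det_regGram hk hs z
  have h2 := log_det_regGram hk hs (fun i => z (Fin.castSucc i))
  have h3 := posteriorVar_nonneg hk hs (fun i => z (Fin.castSucc i)) (z (Fin.last t))
  rw [det_regGram_succ hk hs, Real.log_mul (det_regGram_pos hk hs _).ne' (by linarith)] at h1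
  have h4 : 1 + posteriorVar k s (fun i => z (Fin.castSucc i)) (z (Fin.last t)) / s =
      (s + posteriorVar k s (fun i => z (Fin.castSucc i)) (z (Fin.last t))) / s := by
    field_simp
  rw [h4, Real.log_div (by linarith) hs.ne']
  push_cast at h1
  linarith

theorem infoGain_zero (z : Fin 0 → X) : infoGain k s z = 0 := by
  rw [infoGain, Matrix.det_fin_zero, Real.log_one, mul_zero]

theorem infoGain_seq (hk : ∀ x y, k x y = ⟪φ x, φ y⟫_ℝ) (hs : 0 < s) (x : ℕ → X) (n : ℕ) :
    infoGain k s (fun i : Fin n => x i) = 1 / 2 * ∑ t ∈ Finset.range n,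
      Real.log (1 + posteriorVar k s (fun i : Fin t => x i) (x t) / s) := by
  induction n with
  | zero => rw [infoGain_zero]; simp
  | succ n ih =>
    rw [infoGain_succ hk hs, Finset.sum_range_succ, mul_add, ← ih]
    rfl

theorem abs_kernel_le (hk : ∀ x y, k x y = ⟪φ x, φ y⟫_ℝ) {B : ℝ} (hB : ∀ x, k x x ≤ B) (x y : X) :
    |k x y| ≤ B := by
  have h : ∀ x, ‖φ x‖ ^ 2 ≤ B := fun x => by
    rw [← real_inner_self_eq_norm_sq, ← hk]; exact hB x
  rw [hk]
  refine (abs_real_inner_le_norm _ _).trans ?_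
  nlinarith [h x, h y, sq_nonneg (‖φ x‖ - ‖φ y‖)]

/-- Each query contributes at most ln(1 + B/s)/2. Boundedness matters because the real supremum of
an unbounded family is 0 by convention. -/
theorem bddAbove_infoGain (hk : ∀ x y, k x y = ⟪φ x, φ y⟫_ℝ) (hs : 0 < s) {B : ℝ}
    (hB : ∀ x, k x x ≤ B) (t : ℕ) : BddAbove (Set.range fun z : Fin t → X => infoGain k s z) := by
  refine ⟨1 / 2 * ∑ i ∈ Finset.range t, Real.log (1 + B / s), ?_⟩
  rintro _ ⟨z, rfl⟩
  induction t with
  | zero => simp [infoGain_zero]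
  | succ t ih =>
    have h0 := posteriorVar_nonneg hk hs (fun i => z (Fin.castSucc i)) (z (Fin.last t))
    have h1 := (posteriorVar_le hk hs (fun i => z (Fin.castSucc i)) (z (Fin.last t))).trans
      (hB (z (Fin.last t)))
    have h2 := ih (fun i => z (Fin.castSucc i))
    change infoGain k s z ≤ _
    rw [infoGain_succ hk hs, Finset.sum_range_succ, mul_add]
    gcongr

theorem infoGain_le_maxInfoGain (hk : ∀ x y, k x y = ⟪φ x, φ y⟫_ℝ) (hs : 0 < s) {B : ℝ}
    (hB : ∀ x, k x x ≤ B) (z : Fin t → X) : infoGain k s z ≤ maxInfoGain k s t :=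
  le_ciSup (bddAbove_infoGain hk hs hB t) z

theorem maxInfoGain_mono [Nonempty X] (hk : ∀ x y, k x y = ⟪φ x, φ y⟫_ℝ) (hs : 0 < s) {B : ℝ}
    (hB : ∀ x, k x x ≤ B) : Monotone (maxInfoGain k s) := by
  refine monotone_nat_of_le_succ fun t => ciSup_le fun z => ?_
  obtain ⟨x⟩ := ‹Nonempty X›
  refine le_trans ?_ (infoGain_le_maxInfoGain hk hs hB (Fin.snoc z x : Fin (t + 1) → X))
  rw [infoGain_succ hk hs]
  simp only [Fin.snoc_castSucc, Fin.snoc_last]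
  have h0 := posteriorVar_nonneg hk hs z x
  have : 0 ≤ Real.log (1 + posteriorVar k s z x / s) :=
    Real.log_nonneg (by have := div_nonneg h0 hs.le; linarith)
  linarith

/-- A single query at `x` already yields this gain. The bound lets additive constants in β be
absorbed into γ̂_n. -/
theorem le_maxInfoGain_of_le (hk : ∀ x y, k x y = ⟪φ x, φ y⟫_ℝ) (hs : 0 < s) {B κ : ℝ}
    (hκ : 0 < κ) (hB : ∀ x, k x x ≤ B) {x : X} (hx : κ ≤ k x x) {n : ℕ} (hn : 1 ≤ n) :
    1 / 2 * Real.log (1 + κ / s) ≤ maxInfoGain k s n := by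
  have : Nonempty X := ⟨x⟩
  refine le_trans ?_ ((infoGain_le_maxInfoGain hk hs hB (fun _ : Fin 1 => x)).trans
    (maxInfoGain_mono hk hs hB hn))
  have h0 : posteriorVar k s (fun _ : Fin 0 => x) x = k x x := by simp [posteriorVar, dotProduct]
  rw [infoGain_succ hk hs, infoGain_zero, zero_add, h0]
  gcongr

/-- The sum of the posterior variances at the queries is controlled by the information gain. -/
theorem sum_posteriorVar_le (hk : ∀ x y, k x y = ⟪φ x, φ y⟫_ℝ) (hs : 1 ≤ s) {B : ℝ}
    (hB : ∀ x, k x x ≤ B) (x : ℕ → X) (n : ℕ) :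
    ∑ t ∈ Finset.range n, posteriorVar k s (fun i : Fin t => x i) (x t) ≤
      2 * (s * (1 + B)) * maxInfoGain k s n := by
  have hs0 : 0 < s := by linarith
  have hB0 : 0 ≤ B := (abs_nonneg _).trans (abs_kernel_le hk hB (x 0) (x 0))
  have h := infoGain_le_maxInfoGain hk hs0 hB (fun i : Fin n => x i)
  rw [infoGain_seq hk hs0] at h
  have h1 : ∑ t ∈ Finset.range n, posteriorVar k s (fun i : Fin t => x i) (x t) ≤
      ∑ t ∈ Finset.range n, s * (1 + B) *
        Real.log (1 + posteriorVar k s (fun i : Fin t => x i) (x t) / s) := by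
    refine Finset.sum_le_sum fun t _ => ?_
    have hp0 := posteriorVar_nonneg hk hs0 (fun i : Fin t => x i) (x t)
    have hp1 := (posteriorVar_le hk hs0 (fun i : Fin t => x i) (x t)).trans (hB (x t))
    set p := posteriorVar k s (fun i : Fin t => x i) (x t)
    have hu0 : 0 ≤ p / s := div_nonneg hp0 hs0.le
    have hu1 : p / s ≤ B := (div_le_self hp0 hs).trans hp1
    have hlog : 1 - (1 + p / s)⁻¹ ≤ Real.log (1 + p / s) :=
      Real.one_sub_inv_le_log_of_pos (by linarith)
    -- The inequality ln q ≥ 1 - 1/q at q = 1 + p/s, multiplied by q ≤ 1 + B.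
    have h2 : p / s ≤ (1 + B) * Real.log (1 + p / s) := by
      have h3 : p / s = (1 + p / s) * (1 - (1 + p / s)⁻¹) := by
        field_simp; ring
      have h4 : 0 ≤ 1 - (1 + p / s)⁻¹ := by
        rw [sub_nonneg]; exact inv_le_one_of_one_le₀ (by linarith)
      calc p / s = (1 + p / s) * (1 - (1 + p / s)⁻¹) := h3
        _ ≤ (1 + B) * Real.log (1 + p / s) := by gcongr
    calc p = s * (p / s) := by field_simp
      _ ≤ s * ((1 + B) * Real.log (1 + p / s)) := by gcongr
      _ = _ := by ring
  rw [← Finset.mul_sum] at h1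
  refine h1.trans ?_
  have : 0 ≤ s * (1 + B) := by positivity
  nlinarith

end Extension

end

/-! ### Conditional integrals, Gaussian mixtures, Ville's inequality -/

noncomputable section

section ConditionalIntegrals

variable {Ω : Type*} {m mΩ : MeasurableSpace Ω} {μ : Measure Ω}

/-- On `m` the measure with density `F` is dominated by `c • μ`, so an `m`-measurable weight can be
integrated against both. Working with lower integrals avoids integrability conditions on the
product. -/
theorem lintegral_mul_le_of_setLIntegral_le (hm : m ≤ mΩ) {F : Ω → ENNReal} (hF : Measurable F)
    {c : ENNReal} (h : ∀ A, MeasurableSet[m] A → ∫⁻ ω in A, F ω ∂μ ≤ c * μ A)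
    {g : Ω → ENNReal} (hg : Measurable[m] g) :
    ∫⁻ ω, g ω * F ω ∂μ ≤ c * ∫⁻ ω, g ω ∂μ := by
  have h1 : (μ.withDensity F).trim hm ≤ c • μ.trim hm := by
    refine Measure.le_iff.mpr fun A hA => ?_
    rw [trim_measurableSet_eq hm hA, withDensity_apply _ (hm A hA), Measure.smul_apply, smul_eq_mul,
      trim_measurableSet_eq hm hA]
    exact h A hA
  calc ∫⁻ ω, g ω * F ω ∂μ = ∫⁻ ω, g ω ∂(μ.withDensity F) := by
        rw [lintegral_withDensity_eq_lintegral_mul μ hF (hg.mono hm le_rfl)]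
        exact lintegral_congr fun ω => mul_comm _ _
    _ = ∫⁻ ω, g ω ∂((μ.withDensity F).trim hm) := (lintegral_trim hm hg).symm
    _ ≤ ∫⁻ ω, g ω ∂(c • μ.trim hm) := lintegral_mono' h1 le_rfl
    _ = c * ∫⁻ ω, g ω ∂μ := by rw [lintegral_smul_measure, lintegral_trim hm hg, smul_eq_mul]

theorem setLIntegral_ofReal_le_of_condExp_le [IsFiniteMeasure μ] (hm : m ≤ mΩ) {F : Ω → ℝ}
    (hF : Integrable F μ) (hF0 : 0 ≤ F) {c : ℝ} (h : μ[F | m] ≤ᵐ[μ] fun _ => c)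
    {A : Set Ω} (hA : MeasurableSet[m] A) :
    ∫⁻ ω in A, ENNReal.ofReal (F ω) ∂μ ≤ ENNReal.ofReal c * μ A := by
  rw [← ofReal_integral_eq_lintegral_ofReal hF.integrableOn (ae_of_all _ hF0),
    ← setIntegral_condExp hm hF hA]
  have h1 : ∫ ω in A, (μ[F | m]) ω ∂μ ≤ ∫ _ in A, c ∂μ :=
    integral_mono_ae integrable_condExp.integrableOn (integrable_const c) (ae_restrict_of_ae h)
  rw [setIntegral_const, smul_eq_mul] at h1
  refine (ENNReal.ofReal_le_ofReal h1).trans ?_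
  rw [ENNReal.ofReal_mul measureReal_nonneg, ofReal_measureReal, mul_comm]

/-- Likelihood ratio of `N(a, 1 + v)` and `N(0, 1)` as a mixture of exponential tilts. -/
theorem lintegral_gaussian_tilt {v : ℝ} (hv : 0 < v) (a y : ℝ) :
    ∫⁻ h : ℝ, ENNReal.ofReal ((√(2 * Real.pi * v))⁻¹ * Real.exp (-(h - a) ^ 2 / (2 * v))) *
        ENNReal.ofReal (Real.exp (h * y - h ^ 2 / 2)) =
      ENNReal.ofReal ((√(1 + v))⁻¹ * Real.exp (y ^ 2 / 2 - (y - a) ^ 2 / (2 * (1 + v)))) := by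
  have hw : 0 < 1 + v := by linarith
  have hq : 0 < v / (1 + v) := by positivity
  set q : NNReal := ⟨v / (1 + v), hq.le⟩ with hqdef
  have hq0 : q ≠ 0 := fun h => hq.ne' (congrArg NNReal.toReal h)
  -- Completing the square in h: given y, the mixing variable is distributed as N((a + vy)/(1 + v),
  -- v/(1 + v)).
  have hpt : ∀ h : ℝ,
      ENNReal.ofReal ((√(2 * Real.pi * v))⁻¹ * Real.exp (-(h - a) ^ 2 / (2 * v))) *
        ENNReal.ofReal (Real.exp (h * y - h ^ 2 / 2)) =
      ENNReal.ofReal ((√(1 + v))⁻¹ * Real.exp (y ^ 2 / 2 - (y - a) ^ 2 / (2 * (1 + v)))) *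
        gaussianPDF ((a + v * y) / (1 + v)) q h := by
    intro h
    rw [gaussianPDF, ← ENNReal.ofReal_mul (by positivity), ← ENNReal.ofReal_mul (by positivity),
      gaussianPDFReal]
    congr 1
    have hqc : (q : ℝ) = v / (1 + v) := rfl
    have h1 : √(2 * Real.pi * v) = √(1 + v) * √(2 * Real.pi * (v / (1 + v))) := by
      rw [← Real.sqrt_mul hw.le]
      congr 1
      field_simp
    rw [hqc, h1, mul_inv]
    have h2 : Real.exp (-(h - a) ^ 2 / (2 * v)) * Real.exp (h * y - h ^ 2 / 2) =
        Real.exp (y ^ 2 / 2 - (y - a) ^ 2 / (2 * (1 + v))) *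
          Real.exp (-(h - (a + v * y) / (1 + v)) ^ 2 / (2 * (v / (1 + v)))) := by
      rw [← Real.exp_add, ← Real.exp_add]
      congr 1
      field_simp
      ring
    calc _ = (√(1 + v))⁻¹ * (√(2 * Real.pi * (v / (1 + v))))⁻¹ *
          (Real.exp (-(h - a) ^ 2 / (2 * v)) * Real.exp (h * y - h ^ 2 / 2)) := by ring
      _ = _ := by rw [h2]; ring
  rw [lintegral_congr hpt, lintegral_const_mul _ (measurable_gaussianPDF _ _),
    lintegral_gaussianPDF_eq_one _ hq0, mul_one]

theorem lintegral_gaussian_density {v : ℝ} (hv : 0 < v) (a : ℝ) :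
    ∫⁻ h : ℝ, ENNReal.ofReal ((√(2 * Real.pi * v))⁻¹ * Real.exp (-(h - a) ^ 2 / (2 * v))) = 1 := by
  have h := lintegral_gaussianPDF_eq_one a (v := ⟨v, hv.le⟩)
    (fun h => hv.ne' (congrArg NNReal.toReal h))
  exact h

/-- If `ξ` is conditionally `1`-sub-Gaussian, then the expected likelihood ratio of `N(a, 1 + v)`
and `N(0, 1)` at `ξ` is at most `1` for predictable `a` and `v`. -/
theorem lintegral_mul_likelihoodRatio_le [IsFiniteMeasure μ] (hm : m ≤ mΩ) {ξ a v : Ω → ℝ}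
    (hξ : Measurable ξ) (ha : Measurable[m] a) (hv : Measurable[m] v) (hv0 : ∀ ω, 0 < v ω)
    (h : ∀ (l : ℝ) (A : Set Ω), MeasurableSet[m] A →
      ∫⁻ ω in A, ENNReal.ofReal (Real.exp (l * ξ ω)) ∂μ ≤
        ENNReal.ofReal (Real.exp (l ^ 2 / 2)) * μ A)
    {g : Ω → ENNReal} (hg : Measurable[m] g) :
    ∫⁻ ω, g ω * ENNReal.ofReal ((√(1 + v ω))⁻¹ *
        Real.exp (ξ ω ^ 2 / 2 - (ξ ω - a ω) ^ 2 / (2 * (1 + v ω)))) ∂μ ≤ ∫⁻ ω, g ω ∂μ := by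
  set p : Ω → ℝ → ENNReal := fun ω l =>
    ENNReal.ofReal ((√(2 * Real.pi * v ω))⁻¹ * Real.exp (-(l - a ω) ^ 2 / (2 * v ω))) with hp
  have ha' := ha.mono hm le_rfl
  have hv' := hv.mono hm le_rfl
  have hg' := hg.mono hm le_rfl
  have hpm : Measurable (Function.uncurry p) := by
    simp only [hp]
    refine Measurable.ennreal_ofReal (Measurable.mul ?_ ?_)
    · exact ((hv'.comp measurable_fst).const_mul _).sqrt.inv
    · refine Real.measurable_exp.comp (Measurable.div ?_ ((hv'.comp measurable_fst).const_mul _))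
      exact ((measurable_snd.sub (ha'.comp measurable_fst)).pow_const 2).neg
  have hpω : ∀ ω, Measurable (p ω) := fun ω => hpm.comp measurable_prodMk_left
  have hpl : ∀ l, Measurable[m] fun ω => p ω l := fun l => by
    simp only [hp]
    refine Measurable.ennreal_ofReal (Measurable.mul ?_ ?_)
    · exact (hv.const_mul _).sqrt.inv
    · exact Real.measurable_exp.comp (((measurable_const.sub ha).pow_const 2).neg.div
        (hv.const_mul _))
  have hem : Measurable fun q : Ω × ℝ => ENNReal.ofReal (Real.exp (q.2 * ξ q.1 - q.2 ^ 2 / 2)) :=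
    Measurable.ennreal_ofReal (Real.measurable_exp.comp
      ((measurable_snd.mul (hξ.comp measurable_fst)).sub ((measurable_snd.pow_const 2).div_const 2)))
  calc _ = ∫⁻ ω, (∫⁻ l, g ω * (p ω l * ENNReal.ofReal (Real.exp (l * ξ ω - l ^ 2 / 2)))) ∂μ := by
        refine lintegral_congr fun ω => ?_
        rw [← lintegral_gaussian_tilt (hv0 ω), ← lintegral_const_mul]
        exact (hpω ω).mul (hem.comp measurable_prodMk_left)
    _ = ∫⁻ l, ∫⁻ ω, g ω * (p ω l * ENNReal.ofReal (Real.exp (l * ξ ω - l ^ 2 / 2))) ∂μ := by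
        refine lintegral_lintegral_swap (Measurable.aemeasurable ?_)
        exact (hg'.comp measurable_fst).mul (hpm.mul hem)
    -- For a fixed tilt l the weight `g ω * p ω l` is `m`-measurable, and exp(lξ - l²/2) has
    -- conditional mean at most 1.
    _ ≤ ∫⁻ l, ∫⁻ ω, g ω * p ω l ∂μ := by
        refine lintegral_mono fun l => ?_
        have h1 : ∀ ω, g ω * (p ω l * ENNReal.ofReal (Real.exp (l * ξ ω - l ^ 2 / 2))) =
            ENNReal.ofReal (Real.exp (-(l ^ 2 / 2))) *
              (g ω * p ω l * ENNReal.ofReal (Real.exp (l * ξ ω))) := fun ω => by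
          rw [sub_eq_add_neg, Real.exp_add, ENNReal.ofReal_mul (Real.exp_nonneg _)]
          ring
        have hle := lintegral_mul_le_of_setLIntegral_le hm
          (Measurable.ennreal_ofReal (Real.measurable_exp.comp (hξ.const_mul l))) (h l)
          (hg.mul (hpl l))
        simp only [h1]
        rw [lintegral_const_mul]
        · refine (mul_le_mul_right hle _).trans ?_
          rw [← mul_assoc, ← ENNReal.ofReal_mul (Real.exp_nonneg _), ← Real.exp_add]
          simp
        · exact (hg'.mul ((hpl l).mono hm le_rfl)).mul
            (Measurable.ennreal_ofReal (Real.measurable_exp.comp (hξ.const_mul l)))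
    _ = ∫⁻ ω, (∫⁻ l, g ω * p ω l) ∂μ := by
        refine (lintegral_lintegral_swap (Measurable.aemeasurable ?_)).symm
        exact (hg'.comp measurable_fst).mul hpm
    _ = ∫⁻ ω, g ω ∂μ := by
        refine lintegral_congr fun ω => ?_
        rw [lintegral_const_mul _ (hpω ω), lintegral_gaussian_density (hv0 ω), mul_one]

/-- Ville's inequality over a finite horizon. -/
theorem mul_measure_exists_le_one {mΩ : MeasurableSpace Ω} {μ : Measure Ω} {ℱ : Filtration ℕ mΩ}
    {n : ℕ} {M : ℕ → Ω → ENNReal} (hM : ∀ t ≤ n, Measurable[ℱ t] (M t))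
    (h0 : ∫⁻ ω, M 0 ω ∂μ ≤ 1)
    (hstep : ∀ t < n, ∀ A, MeasurableSet[ℱ t] A → ∫⁻ ω in A, M (t + 1) ω ∂μ ≤ ∫⁻ ω in A, M t ω ∂μ)
    (a : ENNReal) : a * μ {ω | ∃ t ≤ n, a ≤ M t ω} ≤ 1 := by
  set S : ℕ → Set Ω := fun t => {ω | ∃ r ≤ t, a ≤ M r ω} with hS
  have hset : ∀ t ≤ n, MeasurableSet[ℱ t] {ω | a ≤ M t ω} := fun t ht =>
    hM t ht measurableSet_Ici
  have hSsucc : ∀ t, S (t + 1) = S t ∪ {ω | a ≤ M (t + 1) ω} := fun t => by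
    ext ω
    simp only [hS, Set.mem_ofPred_eq, Set.mem_union]
    constructor
    · rintro ⟨r, hr, h⟩
      rcases Nat.lt_or_ge t r with h1 | h1
      · obtain rfl : r = t + 1 := by omega
        exact Or.inr h
      · exact Or.inl ⟨r, h1, h⟩
    · rintro (⟨r, hr, h⟩ | h)
      · exact ⟨r, by omega, h⟩
      · exact ⟨t + 1, le_rfl, h⟩
  have hS0 : S 0 = {ω | a ≤ M 0 ω} := by
    ext ω
    simp [hS]
  have hSm : ∀ t ≤ n, MeasurableSet[ℱ t] (S t) := by
    intro t
    induction t with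
    | zero => intro _; rw [hS0]; exact hset 0 (Nat.zero_le n)
    | succ t ih =>
      intro ht
      rw [hSsucc]
      exact (ℱ.mono (Nat.le_succ t) _ (ih (by omega))).union (hset _ ht)
  have hmarkov : ∀ t ≤ n, ∀ A : Set Ω, MeasurableSet A →
      ∫⁻ ω in A \ {ω | a ≤ M t ω}, M t ω ∂μ + a * μ (A ∩ {ω | a ≤ M t ω}) ≤
        ∫⁻ ω in A, M t ω ∂μ := by
    intro t ht A hA
    have hm := ℱ.le t _ (hset t ht)
    rw [← lintegral_inter_add_sdiff (μ := μ) (M t) A hm, add_comm]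
    gcongr
    rw [← setLIntegral_const]
    exact setLIntegral_mono' (hA.inter hm) fun ω hω => hω.2
  -- Optional stopping by hand: paths that have reached the level are frozen at value a, the others
  -- still carry `M t`.
  have key : ∀ t ≤ n, ∫⁻ ω in (S t)ᶜ, M t ω ∂μ + a * μ (S t) ≤ 1 := by
    intro t
    induction t with
    | zero =>
      intro _
      have := hmarkov 0 (Nat.zero_le n) Set.univ MeasurableSet.univ
      rw [Set.univ_inter, ← Set.compl_eq_univ_sdiff, setLIntegral_univ] at this
      rw [hS0]
      exact this.trans h0
    | succ t ih =>
      intro ht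
      have hSt := ℱ.le t _ (hSm t (by omega))
      have h1 := hmarkov (t + 1) ht (S t)ᶜ hSt.compl
      have h2 := hstep t (by omega) (S t)ᶜ (hSm t (by omega)).compl
      have h3 : (S (t + 1))ᶜ = (S t)ᶜ \ {ω | a ≤ M (t + 1) ω} := by
        rw [hSsucc, Set.compl_union]; rfl
      have h4 : μ (S (t + 1)) ≤ μ (S t) + μ ((S t)ᶜ ∩ {ω | a ≤ M (t + 1) ω}) := by
        rw [hSsucc, ← Set.union_sdiff_self, Set.sdiff_eq, Set.inter_comm _ (S t)ᶜ]
        exact measure_union_le _ _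
      rw [h3]
      calc _ ≤ ∫⁻ ω in (S t)ᶜ \ {ω | a ≤ M (t + 1) ω}, M (t + 1) ω ∂μ +
            a * (μ (S t) + μ ((S t)ᶜ ∩ {ω | a ≤ M (t + 1) ω})) := by gcongr
        _ = (∫⁻ ω in (S t)ᶜ \ {ω | a ≤ M (t + 1) ω}, M (t + 1) ω ∂μ +
            a * μ ((S t)ᶜ ∩ {ω | a ≤ M (t + 1) ω})) + a * μ (S t) := by ring
        _ ≤ ∫⁻ ω in (S t)ᶜ, M t ω ∂μ + a * μ (S t) := by gcongr; exact h1.trans h2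
        _ ≤ 1 := ih (by omega)
  exact le_add_self.trans (key n le_rfl)

end ConditionalIntegrals

/-! ### Conditional law of the total noise -/

section ProcessNoise

variable {Ω E X : Type*} {mΩ : MeasurableSpace Ω} [mE : MeasurableSpace E] [MeasurableSpace X]
  {μ : Measure Ω} [IsProbabilityMeasure μ] {ℱ : Filtration ℕ mΩ} {n : ℕ} {P : Kernel X E}
  [IsMarkovKernel P] {σE σζ : ℝ} {x : ℕ → Ω → X} {u : ℕ → Ω → E} {ζ : ℕ → Ω → ℝ} {f : E → ℝ}

/-- Integration over the evaluated input conditionally on the available information. -/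
theorem IsUncertainInputProcess.setLIntegral_query_input
    (hp : IsUncertainInputProcess μ ℱ n P σζ x u ζ) {t : ℕ} (ht : t < n) {A : Set Ω}
    (hA : MeasurableSet[ℱ t] A) {F : X × E → ENNReal} (hF : Measurable F) :
    ∫⁻ ω in A, F (x t ω, u t ω) ∂μ = ∫⁻ ω in A, ∫⁻ v, F (x t ω, v) ∂(P (x t ω)) ∂μ := by
  have hx : Measurable (x t) := (hp.measurable_query t ht).mono (ℱ.le t) le_rfl
  have hu : Measurable (u t) := (hp.measurable_input t ht).mono (ℱ.le (t + 1)) le_rfl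
  have hxu : Measurable fun ω => (x t ω, u t ω) := hx.prodMk hu
  -- The conditional law is given one event at a time; agreement on rectangles determines the joint
  -- law of query and input.
  have hmeas : (μ.restrict A).map (fun ω => (x t ω, u t ω)) = ((μ.restrict A).map (x t)) ⊗ₘ P := by
    have : IsFiniteMeasure ((μ.restrict A).map (fun ω => (x t ω, u t ω))) := inferInstance
    refine Measure.ext_prod fun {S T} hS hT => ?_
    have hS' : MeasurableSet[ℱ t] (x t ⁻¹' S) := hp.measurable_query t ht hS
    have hSA : MeasurableSet[ℱ t] (x t ⁻¹' S ∩ A) := hS'.inter hA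
    have hTu : MeasurableSet (u t ⁻¹' T) := hu hT
    rw [Measure.map_apply hxu (hS.prod hT), Measure.compProd_apply_prod hS hT,
      setLIntegral_map hS (P.measurable_coe hT) hx, Measure.restrict_restrict (ℱ.le t _ hS'),
      Measure.restrict_apply (hxu (hS.prod hT))]
    have h1 : (fun ω => (x t ω, u t ω)) ⁻¹' S ×ˢ T ∩ A = u t ⁻¹' T ∩ (x t ⁻¹' S ∩ A) := by
      ext ω; simp only [Set.mem_inter_iff, Set.mem_preimage, Set.mem_prod]; tauto
    rw [h1]
    have hint : Integrable ((u t ⁻¹' T).indicator fun _ => (1 : ℝ)) μ :=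
      (integrable_const 1).indicator hTu
    have h2 := setIntegral_condExp (ℱ.le t) hint hSA
    rw [integral_congr_ae (ae_restrict_of_ae (hp.input_law t ht T hT)),
      integral_indicator_const _ hTu] at h2
    rw [measureReal_restrict_apply hTu, smul_eq_mul, mul_one] at h2
    have h3 : ∫⁻ ω in x t ⁻¹' S ∩ A, P (x t ω) T ∂μ =
        ENNReal.ofReal (∫ ω in x t ⁻¹' S ∩ A, (P (x t ω)).real T ∂μ) := by
      rw [ofReal_integral_eq_lintegral_ofReal]
      · exact lintegral_congr fun ω => (ofReal_measureReal (measure_ne_top _ _)).symm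
      · refine Integrable.of_bound (C := 1)
          ((P.measurable_coe hT).comp hx).ennreal_toReal.aestronglyMeasurable
          (ae_of_all _ fun ω => ?_)
        rw [Real.norm_of_nonneg measureReal_nonneg]
        exact measureReal_le_one
      · exact ae_of_all _ fun ω => measureReal_nonneg
    rw [h3, h2, ofReal_measureReal]
  calc ∫⁻ ω in A, F (x t ω, u t ω) ∂μ = ∫⁻ q, F q ∂((μ.restrict A).map fun ω => (x t ω, u t ω)) :=
        (lintegral_map hF hxu).symm
    _ = ∫⁻ y, ∫⁻ v, F (y, v) ∂(P y) ∂((μ.restrict A).map (x t)) := by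
        rw [hmeas, Measure.lintegral_compProd hF]
    _ = _ := lintegral_map (hF.lintegral_kernel_prod_right') hx

/-- The total observation noise is conditionally sub-Gaussian. -/
theorem IsUncertainInputProcess.setLIntegral_exp_noise_le
    (hp : IsUncertainInputProcess μ ℱ n P σζ x u ζ) (hf : Measurable f)
    (hE : InputNoiseSubGaussian P f σE) {t : ℕ} (ht : t < n) (l : ℝ) {A : Set Ω}
    (hA : MeasurableSet[ℱ t] A) :
    ∫⁻ ω in A, ENNReal.ofReal (Real.exp (l *
        (f (u t ω) + ζ t ω - ∫ v, f v ∂(P (x t ω))))) ∂μ ≤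
      ENNReal.ofReal (Real.exp (l ^ 2 * (σE ^ 2 + σζ ^ 2) / 2)) * μ A := by
  have hmean : Measurable fun y => ∫ v, f v ∂(P y) :=
    (StronglyMeasurable.integral_kernel hf.stronglyMeasurable).measurable
  have hu : Measurable (u t) := (hp.measurable_input t ht).mono (ℱ.le (t + 1)) le_rfl
  have hζ : Measurable (ζ t) := (hp.measurable_noise t ht).mono (ℱ.le (t + 1)) le_rfl
  have hm : (ℱ t : MeasurableSpace Ω) ⊔ mE.comap (u t) ≤ mΩ := sup_le (ℱ.le t) hu.comap_le
  have hu' : Measurable[(ℱ t : MeasurableSpace Ω) ⊔ mE.comap (u t)] (u t) :=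
    (comap_measurable (u t)).mono le_sup_right le_rfl
  have hx' : Measurable[(ℱ t : MeasurableSpace Ω) ⊔ mE.comap (u t)] (x t) :=
    (hp.measurable_query t ht).mono le_sup_left le_rfl
  set g : Ω → ENNReal := fun ω =>
    ENNReal.ofReal (Real.exp (l * (f (u t ω) - ∫ v, f v ∂(P (x t ω))))) with hg
  have hgm : Measurable[(ℱ t : MeasurableSpace Ω) ⊔ mE.comap (u t)] g :=
    Measurable.ennreal_ofReal (Real.measurable_exp.comp
      (((hf.comp hu').sub (hmean.comp hx')).const_mul l))
  have hA' : MeasurableSet[(ℱ t : MeasurableSpace Ω) ⊔ mE.comap (u t)] A :=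
    (le_sup_left : (ℱ t : MeasurableSpace Ω) ≤ _) A hA
  -- Tower property: conditionally on the past and `u t` the input-induced factor `g` is known, so ζ
  -- is averaged first and the input afterwards. The two variance proxies add up.
  have h1 := lintegral_mul_le_of_setLIntegral_le hm (μ := μ)
    (F := fun ω => ENNReal.ofReal (Real.exp (l * ζ t ω)))
    (Measurable.ennreal_ofReal (Real.measurable_exp.comp (hζ.const_mul l)))
    (c := ENNReal.ofReal (Real.exp (l ^ 2 * σζ ^ 2 / 2)))
    (fun S hS => setLIntegral_ofReal_le_of_condExp_le hm (hp.noise_integrable t ht l)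
      (fun ω => Real.exp_nonneg _) (hp.noise_subGaussian t ht l) hS) (hgm.indicator hA')
  have h2 : ∫⁻ ω in A, g ω ∂μ ≤ ENNReal.ofReal (Real.exp (l ^ 2 * σE ^ 2 / 2)) * μ A := by
    have hF : Measurable fun q : X × E =>
        ENNReal.ofReal (Real.exp (l * (f q.2 - ∫ v, f v ∂(P q.1)))) :=
      Measurable.ennreal_ofReal (Real.measurable_exp.comp
        (((hf.comp measurable_snd).sub (hmean.comp measurable_fst)).const_mul l))
    rw [hg, hp.setLIntegral_query_input ht hA hF, ← setLIntegral_const]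
    refine lintegral_mono fun ω => ?_
    obtain ⟨hi, hle⟩ := hE (x t ω) l
    rw [← ofReal_integral_eq_lintegral_ofReal hi (ae_of_all _ fun v => Real.exp_nonneg _)]
    exact ENNReal.ofReal_le_ofReal hle
  calc _ = ∫⁻ ω, A.indicator g ω * ENNReal.ofReal (Real.exp (l * ζ t ω)) ∂μ := by
        rw [← lintegral_indicator (ℱ.le t _ hA)]
        refine lintegral_congr fun ω => ?_
        by_cases hω : ω ∈ A
        · rw [Set.indicator_of_mem hω, Set.indicator_of_mem hω, hg,
            ← ENNReal.ofReal_mul (Real.exp_nonneg _), ← Real.exp_add]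
          congr 2
          ring
        · rw [Set.indicator_of_notMem hω, Set.indicator_of_notMem hω, zero_mul]
    _ ≤ ENNReal.ofReal (Real.exp (l ^ 2 * σζ ^ 2 / 2)) * ∫⁻ ω, A.indicator g ω ∂μ := h1
    _ = ENNReal.ofReal (Real.exp (l ^ 2 * σζ ^ 2 / 2)) * ∫⁻ ω in A, g ω ∂μ := by
        rw [lintegral_indicator (ℱ.le t _ hA)]
    _ ≤ ENNReal.ofReal (Real.exp (l ^ 2 * σζ ^ 2 / 2)) *
          (ENNReal.ofReal (Real.exp (l ^ 2 * σE ^ 2 / 2)) * μ A) := by gcongr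
    _ = _ := by
        rw [← mul_assoc, ← ENNReal.ofReal_mul (Real.exp_nonneg _), ← Real.exp_add]
        congr 3
        ring

end ProcessNoise

end

/-! ### Measurability of the posterior quantities -/

noncomputable section

section PosteriorMeasurability

variable {Ω : Type*} [MeasurableSpace Ω] {ι : Type*} [Fintype ι]

theorem measurable_dotProduct {v w : Ω → ι → ℝ} (hv : ∀ i, Measurable fun ω => v ω i)
    (hw : ∀ i, Measurable fun ω => w ω i) : Measurable fun ω => v ω ⬝ᵥ w ω := by
  simp only [dotProduct]
  exact Finset.measurable_sum _ fun i _ => (hv i).mul (hw i)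

theorem measurable_mulVec_apply {A : Ω → Matrix ι ι ℝ} (hA : ∀ i j, Measurable fun ω => A ω i j)
    {v : Ω → ι → ℝ} (hv : ∀ i, Measurable fun ω => v ω i) (i : ι) :
    Measurable fun ω => (A ω *ᵥ v ω) i :=
  measurable_dotProduct (hA i) hv

variable [DecidableEq ι]

theorem measurable_matrix_det {A : Ω → Matrix ι ι ℝ} (hA : ∀ i j, Measurable fun ω => A ω i j) :
    Measurable fun ω => (A ω).det := by
  have hc : Continuous fun M : ι → ι → ℝ => (Matrix.of M).det :=
    Continuous.matrix_det continuous_id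
  exact hc.measurable.comp (measurable_pi_iff.mpr fun i => measurable_pi_iff.mpr fun j => hA i j)

/-- The inverse is the adjugate over the determinant everywhere, with value 0 at singular matrices,
hence measurable though not continuous. -/
theorem measurable_matrix_inv_apply {A : Ω → Matrix ι ι ℝ}
    (hA : ∀ i j, Measurable fun ω => A ω i j) (i j : ι) : Measurable fun ω => (A ω)⁻¹ i j := by
  have hc : Continuous fun M : ι → ι → ℝ => (Matrix.of M).adjugate i j :=
    (Continuous.matrix_adjugate (A := fun M : ι → ι → ℝ => Matrix.of M) continuous_id).matrix_elem
      i j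
  have hadj : Measurable fun ω => (A ω).adjugate i j :=
    hc.measurable.comp (measurable_pi_iff.mpr fun i => measurable_pi_iff.mpr fun j => hA i j)
  simp only [Matrix.inv_def, Ring.inverse_eq_inv', Matrix.smul_apply, smul_eq_mul]
  exact (measurable_matrix_det hA).inv.mul hadj

variable {X : Type*} [MeasurableSpace X] {k : X → X → ℝ} {s : ℝ} {t : ℕ}

theorem measurable_regGram_apply (hk : Measurable fun p : X × X => k p.1 p.2) {z : Fin t → Ω → X}
    (hz : ∀ i, Measurable (z i)) (i j : Fin t) :
    Measurable fun ω => regGram k s (fun i => z i ω) i j := by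
  simp only [regGram, gramMatrix, Matrix.add_apply, Matrix.of_apply]
  exact (hk.comp ((hz i).prodMk (hz j))).add_const _

theorem measurable_kernelVec_apply (hk : Measurable fun p : X × X => k p.1 p.2)
    {z : Fin t → Ω → X} (hz : ∀ i, Measurable (z i)) {x : Ω → X} (hx : Measurable x) (i : Fin t) :
    Measurable fun ω => kernelVec k (fun i => z i ω) (x ω) i :=
  hk.comp (hx.prodMk (hz i))

theorem measurable_posteriorMean (hk : Measurable fun p : X × X => k p.1 p.2)
    {z : Fin t → Ω → X} (hz : ∀ i, Measurable (z i)) {x : Ω → X} (hx : Measurable x)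
    {y : Fin t → Ω → ℝ} (hy : ∀ i, Measurable (y i)) :
    Measurable fun ω => posteriorMean k s (fun i => z i ω) (fun i => y i ω) (x ω) :=
  measurable_dotProduct (measurable_kernelVec_apply hk hz hx)
    (measurable_mulVec_apply (measurable_matrix_inv_apply (measurable_regGram_apply hk hz)) hy)

theorem measurable_posteriorVar (hk : Measurable fun p : X × X => k p.1 p.2)
    {z : Fin t → Ω → X} (hz : ∀ i, Measurable (z i)) {x : Ω → X} (hx : Measurable x) :
    Measurable fun ω => posteriorVar k s (fun i => z i ω) (x ω) :=
  (hk.comp (hx.prodMk hx)).sub (measurable_dotProduct (measurable_kernelVec_apply hk hz hx)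
    (measurable_mulVec_apply (measurable_matrix_inv_apply (measurable_regGram_apply hk hz))
      (measurable_kernelVec_apply hk hz hx)))

theorem measurable_selfNormSq (hk : Measurable fun p : X × X => k p.1 p.2)
    {z : Fin t → Ω → X} (hz : ∀ i, Measurable (z i))
    {y : Fin t → Ω → ℝ} (hy : ∀ i, Measurable (y i)) :
    Measurable fun ω => selfNormSq k s (fun i => z i ω) (fun i => y i ω) :=
  (measurable_dotProduct hy hy).sub (measurable_dotProduct hy
    (measurable_mulVec_apply (measurable_matrix_inv_apply (measurable_regGram_apply hk hz)) hy))

end PosteriorMeasurability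

/-! ### Self-normalized concentration -/

section SelfNormalized

variable {X V : Type*} [NormedAddCommGroup V] [InnerProductSpace ℝ V] {k : X → X → ℝ} {φ : X → V}
  {s : ℝ}

/-- The increment is twice the exponent in the density ratio of the predictive law N(mean, s +
variance) and N(0, 1) at the new value. -/
theorem selfNormSq_succ (hk : ∀ x y, k x y = ⟪φ x, φ y⟫_ℝ) (hs : 0 < s) {t : ℕ}
    (z : Fin (t + 1) → X) (v : Fin (t + 1) → ℝ) :
    selfNormSq k s z v =
      selfNormSq k s (fun i => z (Fin.castSucc i)) (fun i => v (Fin.castSucc i)) +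
      (v (Fin.last t) ^ 2 - (v (Fin.last t) - posteriorMean k s (fun i => z (Fin.castSucc i))
          (fun i => v (Fin.castSucc i)) (z (Fin.last t))) ^ 2 /
        (s + posteriorVar k s (fun i => z (Fin.castSucc i)) (z (Fin.last t)))) := by
  rw [selfNormSq, selfNormSq, dotProduct_regGram_inv_succ hk hs]
  have h : v ⬝ᵥ v = (fun i => v (Fin.castSucc i)) ⬝ᵥ (fun i => v (Fin.castSucc i)) +
      v (Fin.last t) ^ 2 := by
    simp only [dotProduct, Fin.sum_univ_castSucc, sq]
  rw [h]
  ring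

theorem selfNormSq_div {t : ℕ} (z : Fin t → X) (v : Fin t → ℝ) (R : ℝ) :
    selfNormSq k s z (fun i => v i / R) = selfNormSq k s z v / R ^ 2 := by
  have h : (fun i => v i / R) = R⁻¹ • v := by
    ext i; simp [div_eq_inv_mul]
  rw [h, selfNormSq, selfNormSq, Matrix.mulVec_smul]
  simp only [dotProduct_smul, smul_dotProduct, smul_eq_mul]
  ring

/-- The likelihood ratio of the Gaussian process model and the standard Gaussian noise model. -/
def noiseLikelihoodRatio (k : X → X → ℝ) (s : ℝ) (x : ℕ → X) (v : ℕ → ℝ) (t : ℕ) : ℝ :=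
  (√(regGram k s (fun i : Fin t => x i)).det)⁻¹ *
    Real.exp (selfNormSq k s (fun i : Fin t => x i) (fun i : Fin t => v i) / 2)

/-- Chain rule for Gaussian densities. The predictive variance is written 1 + (s - 1 + variance) to
match the mixture of tilts in `lintegral_mul_likelihoodRatio_le`. -/
theorem noiseLikelihoodRatio_succ (hk : ∀ x y, k x y = ⟪φ x, φ y⟫_ℝ) (hs : 0 < s)
    (x : ℕ → X) (v : ℕ → ℝ) (t : ℕ) :
    noiseLikelihoodRatio k s x v (t + 1) = noiseLikelihoodRatio k s x v t *
      ((√(1 + (s - 1 + posteriorVar k s (fun i : Fin t => x i) (x t))))⁻¹ *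
        Real.exp (v t ^ 2 / 2 -
          (v t - posteriorMean k s (fun i : Fin t => x i) (fun i : Fin t => v i) (x t)) ^ 2 /
          (2 * (1 + (s - 1 + posteriorVar k s (fun i : Fin t => x i) (x t)))))) := by
  have h1 := det_regGram_succ hk hs (fun i : Fin (t + 1) => x i)
  have h2 := selfNormSq_succ hk hs (fun i : Fin (t + 1) => x i) (fun i : Fin (t + 1) => v i)
  simp only [Fin.val_castSucc, Fin.val_last] at h1 h2
  have h3 : 1 + (s - 1 + posteriorVar k s (fun i : Fin t => x i) (x t)) =
      s + posteriorVar k s (fun i : Fin t => x i) (x t) := by ring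
  rw [noiseLikelihoodRatio, noiseLikelihoodRatio, h1, h2, h3,
    Real.sqrt_mul (det_regGram_pos hk hs _).le, mul_inv, add_div, Real.exp_add]
  have h4 : ∀ a b w : ℝ, (a - b / w) / 2 = a / 2 - b / (2 * w) := fun a b w => by
    rw [sub_div, div_div, mul_comm w]
  rw [h4]
  ring

/-- Uniform self-normalized concentration of the observation noise. -/
theorem measure_exists_selfNormSq_gt_le {Ω E : Type*} {mΩ : MeasurableSpace Ω}
    [mE : MeasurableSpace E] [MeasurableSpace X] {μ : Measure Ω} [IsProbabilityMeasure μ]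
    {ℱ : Filtration ℕ mΩ} {n : ℕ} {P : Kernel X E} [IsMarkovKernel P] {σE σζ : ℝ}
    {x : ℕ → Ω → X} {u : ℕ → Ω → E} {ζ : ℕ → Ω → ℝ} {f : E → ℝ}
    (hk : ∀ x y, k x y = ⟪φ x, φ y⟫_ℝ) (hs : 1 < s)
    (hkm : Measurable fun p : X × X => k p.1 p.2)
    (hp : IsUncertainInputProcess μ ℱ n P σζ x u ζ) (hf : Measurable f)
    (hE : InputNoiseSubGaussian P f σE) (hR : 0 < σE ^ 2 + σζ ^ 2) {δ : ℝ} (hδ : 0 < δ) :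
    μ {ω | ∃ t ≤ n, (σE ^ 2 + σζ ^ 2) *
        (Real.log (regGram k s (fun i : Fin t => x i ω)).det - 2 * Real.log δ) <
        selfNormSq k s (fun i : Fin t => x i ω)
          (fun i : Fin t => f (u i ω) + ζ i ω - ∫ v, f v ∂(P (x i ω)))} ≤ ENNReal.ofReal δ := by
  have hs0 : 0 < s := by linarith
  set R := √(σE ^ 2 + σζ ^ 2) with hRdef
  have hR0 : 0 < R := Real.sqrt_pos.mpr hR
  have hR2 : R ^ 2 = σE ^ 2 + σζ ^ 2 := Real.sq_sqrt hR.le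
  have hmean : Measurable fun y => ∫ v, f v ∂(P y) :=
    (StronglyMeasurable.integral_kernel hf.stronglyMeasurable).measurable
  set η : ℕ → Ω → ℝ := fun t ω => f (u t ω) + ζ t ω - ∫ v, f v ∂(P (x t ω)) with hη
  set ξ : ℕ → Ω → ℝ := fun t ω => η t ω / R with hξ
  set M : ℕ → Ω → ENNReal := fun t ω =>
    ENNReal.ofReal (noiseLikelihoodRatio k s (fun i => x i ω) (fun i => ξ i ω) t) with hM
  have hxm : ∀ t ≤ n, ∀ i : Fin t, Measurable[ℱ t] (x i) := fun t ht i =>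
    (hp.measurable_query i (by omega)).mono (ℱ.mono i.2.le) le_rfl
  have hξm' : ∀ t < n, Measurable[ℱ (t + 1)] (ξ t) := fun t ht =>
    (((hf.comp (hp.measurable_input t ht)).add (hp.measurable_noise t ht)).sub
      (hmean.comp ((hp.measurable_query t ht).mono (ℱ.mono (Nat.le_succ t)) le_rfl))).div_const R
  have hξm : ∀ t ≤ n, ∀ i : Fin t, Measurable[ℱ t] (ξ i) := fun t ht i =>
    (hξm' i (by omega)).mono (ℱ.mono i.2) le_rfl
  have hMm : ∀ t ≤ n, Measurable[ℱ t] (M t) := fun t ht =>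
    Measurable.ennreal_ofReal ((@measurable_matrix_det Ω (ℱ t) _ _ _ _
      (@measurable_regGram_apply Ω (ℱ t) _ _ _ _ _ hkm _ (hxm t ht))).sqrt.inv.mul
      (Real.measurable_exp.comp
        ((@measurable_selfNormSq Ω (ℱ t) _ _ _ _ _ hkm _ (hxm t ht) _ (hξm t ht)).div_const 2)))
  have hM0 : ∫⁻ ω, M 0 ω ∂μ ≤ 1 := by
    have : ∀ ω, M 0 ω = 1 := fun ω => by
      simp [hM, noiseLikelihoodRatio, selfNormSq, dotProduct]
    simp [this]
  have hstep : ∀ t < n, ∀ A, MeasurableSet[ℱ t] A →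
      ∫⁻ ω in A, M (t + 1) ω ∂μ ≤ ∫⁻ ω in A, M t ω ∂μ := by
    intro t ht A hA
    have hsub : ∀ (l : ℝ) (A : Set Ω), MeasurableSet[ℱ t] A →
        ∫⁻ ω in A, ENNReal.ofReal (Real.exp (l * ξ t ω)) ∂μ ≤
          ENNReal.ofReal (Real.exp (l ^ 2 / 2)) * μ A := by
      intro l S hS
      have h := hp.setLIntegral_exp_noise_le hf hE ht (l / R) hS
      have h1 : (l / R) ^ 2 * (σE ^ 2 + σζ ^ 2) / 2 = l ^ 2 / 2 := by
        rw [← hR2]; field_simp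
      rw [h1] at h
      refine le_of_eq_of_le (lintegral_congr fun ω => ?_) h
      rw [hξ, hη]
      congr 2
      ring
    -- The mixing variance `v` is positive even where the posterior variance vanishes, because s >
    -- 1.
    have hlr := lintegral_mul_likelihoodRatio_le (μ := μ) (ℱ.le t) (ξ := ξ t)
      (a := fun ω => posteriorMean k s (fun i : Fin t => x i ω) (fun i : Fin t => ξ i ω) (x t ω))
      (v := fun ω => s - 1 + posteriorVar k s (fun i : Fin t => x i ω) (x t ω))
      ((hξm' t ht).mono (ℱ.le _) le_rfl)
      (@measurable_posteriorMean Ω (ℱ t) _ _ _ _ _ hkm _ (hxm t ht.le) _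
        (hp.measurable_query t ht) _ (hξm t ht.le))
      (measurable_const.add (@measurable_posteriorVar Ω (ℱ t) _ _ _ _ _ hkm _
        (hxm t ht.le) _ (hp.measurable_query t ht)))
      (fun ω => by
        have := posteriorVar_nonneg hk hs0 (fun i : Fin t => x i ω) (x t ω)
        linarith)
      hsub ((hMm t ht.le).indicator hA)
    rw [← lintegral_indicator (ℱ.le t _ hA), ← lintegral_indicator (ℱ.le t _ hA)]
    refine le_of_eq_of_le (lintegral_congr fun ω => ?_) hlr
    by_cases hω : ω ∈ A
    · rw [Set.indicator_of_mem hω, Set.indicator_of_mem hω, hM]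
      simp only
      rw [noiseLikelihoodRatio_succ hk hs0, ENNReal.ofReal_mul]
      exact mul_nonneg (inv_nonneg.mpr (Real.sqrt_nonneg _)) (Real.exp_nonneg _)
    · rw [Set.indicator_of_notMem hω, Set.indicator_of_notMem hω, zero_mul]
  have hville := mul_measure_exists_le_one hMm hM0 hstep (ENNReal.ofReal δ⁻¹)
  have hle : μ {ω | ∃ t ≤ n, ENNReal.ofReal δ⁻¹ ≤ M t ω} ≤ ENNReal.ofReal δ := by
    rw [ENNReal.ofReal_inv_of_pos hδ] at hville ⊢
    have h0 : ENNReal.ofReal δ ≠ 0 := by simpa using hδ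
    calc _ = ENNReal.ofReal δ * ((ENNReal.ofReal δ)⁻¹ *
          μ {ω | ∃ t ≤ n, (ENNReal.ofReal δ)⁻¹ ≤ M t ω}) := by
          rw [← mul_assoc, ENNReal.mul_inv_cancel h0 ENNReal.ofReal_ne_top, one_mul]
      _ ≤ ENNReal.ofReal δ * 1 := by gcongr
      _ = _ := mul_one _
  refine (measure_mono ?_).trans hle
  rintro ω ⟨t, ht, hω⟩
  refine ⟨t, ht, ENNReal.ofReal_le_ofReal ?_⟩
  have hdet := det_regGram_pos hk hs0 (fun i : Fin t => x i ω)
  have hsd : selfNormSq k s (fun i : Fin t => x i ω) (fun i : Fin t => ξ i ω) =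
      selfNormSq k s (fun i : Fin t => x i ω) (fun i : Fin t => η i ω) / R ^ 2 :=
    selfNormSq_div _ (fun i : Fin t => η i ω) R
  -- After taking logarithms, M ≥ 1/δ means that the normalized square is at least ln det - 2 ln δ.
  rw [noiseLikelihoodRatio, hsd, ← Real.exp_log (inv_pos.mpr hδ),
    ← Real.exp_log (inv_pos.mpr (Real.sqrt_pos.mpr hdet)), ← Real.exp_add, Real.log_inv,
    Real.log_inv, Real.log_sqrt hdet.le]
  refine Real.exp_le_exp.mpr ?_
  rw [← hR2, ← lt_div_iff₀' (by positivity)] at hω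
  linarith

end SelfNormalized

end

/-! ### Stability of regularized inverses under entrywise errors -/

section Perturbation

variable {ι : Type*} [Fintype ι] [DecidableEq ι] {A A' : Matrix ι ι ℝ} {e : ℝ}

omit [DecidableEq ι] in
-- An entrywise error e changes the quadratic form by at most e|v|₁² ≤ e · card · |v|².
theorem coercive_of_abs_sub_le (hA : ∀ v, v ⬝ᵥ v ≤ v ⬝ᵥ (A *ᵥ v)) (he : 0 ≤ e)
    (h : ∀ i j, |(A' - A) i j| ≤ e) (hcard : Fintype.card ι * e ≤ 1 / 2) (v : ι → ℝ) :
    1 / 2 * (v ⬝ᵥ v) ≤ v ⬝ᵥ (A' *ᵥ v) := by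
  have h1 : v ⬝ᵥ (A' *ᵥ v) = v ⬝ᵥ (A *ᵥ v) + v ⬝ᵥ ((A' - A) *ᵥ v) := by
    rw [Matrix.sub_mulVec, dotProduct_sub]; ring
  have h2 := (abs_le.mp (abs_dotProduct_mulVec_le h v v)).1
  have h3 := mul_le_mul_of_nonneg_left (sum_abs_sq_le v) he
  have h4 := mul_le_mul_of_nonneg_right hcard (dotProduct_self_nonneg_real v)
  have h5 := hA v
  rw [h1]
  nlinarith

theorem sum_abs_inv_mulVec_sq_le (hA' : ∀ v, 1 / 2 * (v ⬝ᵥ v) ≤ v ⬝ᵥ (A' *ᵥ v)) (r : ι → ℝ) :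
    (∑ i, |(A'⁻¹ *ᵥ r) i|) ^ 2 ≤ 4 * (Fintype.card ι * (r ⬝ᵥ r)) := by
  have h1 := sum_abs_sq_le (A'⁻¹ *ᵥ r)
  have h2 := mul_le_mul_of_nonneg_left
    (sq_mul_dotProduct_inv_mulVec_le (by norm_num : (0 : ℝ) < 1 / 2) hA' r)
    (Nat.cast_nonneg (α := ℝ) (Fintype.card ι))
  linarith

theorem sum_abs_inv_mulVec_le (hA' : ∀ v, 1 / 2 * (v ⬝ᵥ v) ≤ v ⬝ᵥ (A' *ᵥ v)) {r : ι → ℝ} {ρ : ℝ}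
    (hρ : 0 ≤ ρ) (hr : ∀ i, |r i| ≤ ρ) :
    ∑ i, |(A'⁻¹ *ᵥ r) i| ≤ 2 * (Fintype.card ι * ρ) := by
  have h1 : r ⬝ᵥ r ≤ Fintype.card ι * ρ ^ 2 := by
    rw [dotProduct, ← nsmul_eq_mul, ← Finset.card_univ]
    refine Finset.sum_le_card_nsmul _ _ _ fun i _ => ?_
    rw [← sq, ← sq_abs]
    exact pow_le_pow_left₀ (abs_nonneg _) (hr i) 2
  refine abs_le_of_sq_le_sq' ((sum_abs_inv_mulVec_sq_le hA' r).trans ?_) (by positivity) |>.2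
  have h2 := mul_le_mul_of_nonneg_left h1 (Nat.cast_nonneg (α := ℝ) (Fintype.card ι))
  linarith

/-- Stability of `κᵀ A⁻¹ r` under entrywise perturbations. -/
theorem abs_dotProduct_inv_mulVec_sub_le (hAs : Aᵀ = A) (hA : ∀ v, v ⬝ᵥ v ≤ v ⬝ᵥ (A *ᵥ v))
    (hA' : ∀ v, 1 / 2 * (v ⬝ᵥ v) ≤ v ⬝ᵥ (A' *ᵥ v))
    (h : ∀ i j, |(A' - A) i j| ≤ e) {κ κ' : ι → ℝ} (hκ : ∀ i, |(κ' - κ) i| ≤ e) (r r' : ι → ℝ) :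
    |κ' ⬝ᵥ (A'⁻¹ *ᵥ r') - κ ⬝ᵥ (A⁻¹ *ᵥ r)| ≤
      e * (1 + ∑ i, |(A⁻¹ *ᵥ κ) i|) * (∑ i, |(A'⁻¹ *ᵥ r') i|) + |(A⁻¹ *ᵥ κ) ⬝ᵥ (r' - r)| := by
  have hAu : IsUnit A.det := isUnit_det_of_coercive one_pos (by simpa using hA)
  have hAu' : IsUnit A'.det := isUnit_det_of_coercive (by norm_num) hA'
  set α := A⁻¹ *ᵥ κ with hα
  set w := A'⁻¹ *ᵥ r' with hw
  -- Resolvent identity: κᵀw = αᵀAw with Aw = r' - (A' - A)w. Only the exact matrix has to be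
  -- symmetric.
  have h1 : κ ⬝ᵥ w = α ⬝ᵥ r' - α ⬝ᵥ ((A' - A) *ᵥ w) := by
    rw [Matrix.sub_mulVec, dotProduct_sub, hw, mulVec_inv_mulVec hAu', ← hw,
      dotProduct_mulVec_comm_of_symm hAs, hα, mulVec_inv_mulVec hAu]
    ring
  have h2 : κ ⬝ᵥ (A⁻¹ *ᵥ r) = α ⬝ᵥ r := by
    rw [dotProduct_mulVec_comm_of_symm (by rw [Matrix.transpose_nonsing_inv, hAs])]
  have h3 : κ' ⬝ᵥ w - κ ⬝ᵥ (A⁻¹ *ᵥ r) =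
      (κ' - κ) ⬝ᵥ w - α ⬝ᵥ ((A' - A) *ᵥ w) + α ⬝ᵥ (r' - r) := by
    rw [sub_dotProduct, h1, h2, dotProduct_sub]
    ring
  rw [h3]
  refine (abs_add_le _ _).trans (add_le_add_left ?_ _)
  refine (abs_sub _ _).trans ?_
  have h4 := abs_dotProduct_le_of_abs_le hκ w
  have h5 := abs_dotProduct_mulVec_le h α w
  linarith

end Perturbation

/-- No signs are assumed, since an estimated variance may be negative, where √ is 0. This modulus of
continuity is the source of √e in the regret. -/
theorem Real.sqrt_le_sqrt_add_sqrt_abs_sub (a b : ℝ) : √a ≤ √b + √|a - b| := by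
  rw [Real.sqrt_le_left (by positivity), add_sq, Real.sq_sqrt (abs_nonneg _)]
  have h1 : b ≤ √b ^ 2 := by
    rcases le_total 0 b with h | h
    · rw [Real.sq_sqrt h]
    · exact h.trans (sq_nonneg _)
  have h2 := le_abs_self (a - b)
  have h3 : 0 ≤ 2 * √b * √|a - b| := by positivity
  linarith

/-! ### Inexact acquisition function and regret of one round -/

noncomputable section

section Acquisition

variable {X V : Type*} [NormedAddCommGroup V] [InnerProductSpace ℝ V] {k k' : X → X → ℝ}
  {φ : X → V} {s e B : ℝ} {t : ℕ}

theorem abs_regGram_sub_le (h : ∀ x y, |k x y - k' x y| ≤ e) (z : Fin t → X) (i j : Fin t) :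
    |(regGram k' s z - regGram k s z) i j| ≤ e := by
  have : (regGram k' s z - regGram k s z) i j = -(k (z i) (z j) - k' (z i) (z j)) := by
    simp [regGram, gramMatrix]
  rw [this, abs_neg]
  exact h _ _

theorem abs_kernelVec_sub_le (h : ∀ x y, |k x y - k' x y| ≤ e) (z : Fin t → X) (x : X)
    (i : Fin t) : |(kernelVec k' z x - kernelVec k z x) i| ≤ e := by
  rw [Pi.sub_apply, abs_sub_comm]
  exact h _ _

theorem dotProduct_le_regGram (hk : ∀ x y, k x y = ⟪φ x, φ y⟫_ℝ) (hs : 1 ≤ s) (z : Fin t → X)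
    (v : Fin t → ℝ) : v ⬝ᵥ v ≤ v ⬝ᵥ (regGram k s z *ᵥ v) :=
  (le_mul_of_one_le_left (dotProduct_self_nonneg_real v) hs).trans (regGram_coercive hk z v)

theorem half_dotProduct_le_regGram (hk : ∀ x y, k x y = ⟪φ x, φ y⟫_ℝ) (hs : 1 ≤ s) (he : 0 ≤ e)
    (h : ∀ x y, |k x y - k' x y| ≤ e) (hte : t * e ≤ 1 / 2) (z : Fin t → X) (v : Fin t → ℝ) :
    1 / 2 * (v ⬝ᵥ v) ≤ v ⬝ᵥ (regGram k' s z *ᵥ v) :=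
  coercive_of_abs_sub_le (dotProduct_le_regGram hk hs z) he (abs_regGram_sub_le h z)
    (by rwa [Fintype.card_fin]) v

theorem sum_abs_regGram_inv_mulVec_kernelVec_le (hk : ∀ x y, k x y = ⟪φ x, φ y⟫_ℝ) (hs : 1 ≤ s)
    (hB0 : 0 ≤ B) (hB : ∀ x, k x x ≤ B) (z : Fin t → X) (x : X) :
    ∑ i, |((regGram k s z)⁻¹ *ᵥ kernelVec k z x) i| ≤ 2 * (t * B) := by
  have h := sum_abs_inv_mulVec_le (A' := regGram k s z) (r := kernelVec k z x) (ρ := B)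
    (fun v => by
      have := dotProduct_le_regGram hk hs z v
      have := dotProduct_self_nonneg_real v
      linarith) hB0 (fun i => abs_kernel_le hk hB x (z i))
  rwa [Fintype.card_fin] at h

theorem abs_posteriorMean_sub_le (hk : ∀ x y, k x y = ⟪φ x, φ y⟫_ℝ) (hs : 1 ≤ s) (he : 0 ≤ e)
    (hB0 : 0 ≤ B) (hB : ∀ x, k x x ≤ B) (h : ∀ x y, |k x y - k' x y| ≤ e) (hte : t * e ≤ 1 / 2)
    (z : Fin t → X) (y : Fin t → ℝ) (x : X) :
    |posteriorMean k' s z y x - posteriorMean k s z y x| ≤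
      e * (1 + 2 * (t * B)) * (2 * √(t * (y ⬝ᵥ y))) := by
  have hA' := half_dotProduct_le_regGram hk hs he h hte z
  have h1 := abs_dotProduct_inv_mulVec_sub_le (regGram_transpose hk z)
    (dotProduct_le_regGram hk hs z) hA'
    (abs_regGram_sub_le h z) (abs_kernelVec_sub_le h z x) y y
  rw [sub_self, dotProduct_zero, abs_zero, add_zero] at h1
  have h2 := sum_abs_inv_mulVec_sq_le hA' y
  rw [Fintype.card_fin] at h2
  have h3 : ∑ i, |((regGram k' s z)⁻¹ *ᵥ y) i| ≤ 2 * √(t * (y ⬝ᵥ y)) := by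
    have := Real.le_sqrt_of_sq_le h2
    rwa [Real.sqrt_mul (by norm_num), show (4 : ℝ) = 2 ^ 2 by norm_num,
      Real.sqrt_sq (by norm_num)] at this
  refine h1.trans ?_
  have h4 := sum_abs_regGram_inv_mulVec_kernelVec_le hk hs hB0 hB z x
  gcongr

theorem abs_posteriorVar_sub_le (hk : ∀ x y, k x y = ⟪φ x, φ y⟫_ℝ) (hs : 1 ≤ s) (he : 0 ≤ e)
    (hB0 : 0 ≤ B) (hB : ∀ x, k x x ≤ B) (h : ∀ x y, |k x y - k' x y| ≤ e) (hte : t * e ≤ 1 / 2)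
    (z : Fin t → X) (x : X) :
    |posteriorVar k' s z x - posteriorVar k s z x| ≤
      e * (1 + 2 * (t * B)) * (1 + 2 * (t * (B + e))) := by
  have hA' := half_dotProduct_le_regGram hk hs he h hte z
  have h1 := abs_dotProduct_inv_mulVec_sub_le (regGram_transpose hk z)
    (dotProduct_le_regGram hk hs z) hA'
    (abs_regGram_sub_le h z) (abs_kernelVec_sub_le h z x) (kernelVec k z x) (kernelVec k' z x)
  have h2 := sum_abs_inv_mulVec_le hA' (r := kernelVec k' z x) (ρ := B + e) (by positivity)
    (fun i => by
      have h3 := abs_le.mp (h x (z i))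
      have h4 := abs_le.mp (abs_kernel_le hk hB x (z i))
      change |k' x (z i)| ≤ _
      rw [abs_le]
      constructor <;> linarith)
  rw [Fintype.card_fin] at h2
  have h4 := sum_abs_regGram_inv_mulVec_kernelVec_le hk hs hB0 hB z x
  have h5 := abs_dotProduct_le_of_abs_le (abs_kernelVec_sub_le h z x)
    ((regGram k s z)⁻¹ *ᵥ kernelVec k z x)
  rw [dotProduct_comm] at h5
  have h6 : posteriorVar k' s z x - posteriorVar k s z x = -(k x x - k' x x) -
      (kernelVec k' z x ⬝ᵥ ((regGram k' s z)⁻¹ *ᵥ kernelVec k' z x) -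
        kernelVec k z x ⬝ᵥ ((regGram k s z)⁻¹ *ᵥ kernelVec k z x)) := by
    rw [posteriorVar, posteriorVar, regGram, regGram]; ring
  set S := ∑ i, |((regGram k s z)⁻¹ *ᵥ kernelVec k z x) i|
  set S' := ∑ i, |((regGram k' s z)⁻¹ *ᵥ kernelVec k' z x) i|
  have hS : 0 ≤ S := Finset.sum_nonneg fun i _ => abs_nonneg _
  have hS' : 0 ≤ S' := Finset.sum_nonneg fun i _ => abs_nonneg _
  rw [h6]
  refine (abs_sub _ _).trans ?_
  rw [abs_neg]
  -- The three errors come from the prior variance, from matrix and left vector, and from the right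
  -- vector; together they factor.
  calc _ ≤ e + (e * (1 + S) * S' + e * S) := add_le_add (h x x) (h1.trans (by gcongr))
    _ = e * (1 + S) * (1 + S') := by ring
    _ ≤ _ := by gcongr

theorem abs_ucbAcquisition_sub_le {Δm Δv β : ℝ} (hβ : 0 ≤ β) (z : Fin t → X) (y : Fin t → ℝ) (x : X)
    (hm : |posteriorMean k' s z y x - posteriorMean k s z y x| ≤ Δm)
    (hv : |posteriorVar k' s z x - posteriorVar k s z x| ≤ Δv) :
    |ucbAcquisition k' s β z y x - ucbAcquisition k s β z y x| ≤ Δm + β * √Δv := by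
  have h1 := Real.sqrt_le_sqrt_add_sqrt_abs_sub (posteriorVar k' s z x) (posteriorVar k s z x)
  have h2 := Real.sqrt_le_sqrt_add_sqrt_abs_sub (posteriorVar k s z x) (posteriorVar k' s z x)
  rw [abs_sub_comm] at h2
  have h3 := Real.sqrt_le_sqrt hv
  have h4 : |√(posteriorVar k' s z x) - √(posteriorVar k s z x)| ≤ √Δv := by
    rw [abs_le]; constructor <;> linarith
  have h5 : ucbAcquisition k' s β z y x - ucbAcquisition k s β z y x =
      (posteriorMean k' s z y x - posteriorMean k s z y x) +
        β * (√(posteriorVar k' s z x) - √(posteriorVar k s z x)) := by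
    rw [ucbAcquisition, ucbAcquisition]; ring
  rw [h5]
  refine (abs_add_le _ _).trans (add_le_add hm ?_)
  rw [abs_mul, abs_of_nonneg hβ]
  gcongr

/-- The instantaneous regret of a query that maximizes an inexact acquisition function. -/
theorem inner_sub_inner_le_of_ucb_maximizer (hk : ∀ x y, k x y = ⟪φ x, φ y⟫_ℝ) (he : 0 ≤ e)
    (hB0 : 0 ≤ B) (hB : ∀ x, k x x ≤ B) (h : ∀ x y, |k x y - k' x y| ≤ e) {n : ℕ}
    (hn : 1 ≤ n) (htn : t ≤ n) (hne : (n : ℝ) ^ 2 * e ≤ 1 / 2) {g : V} {b G : ℝ} (hg : ‖g‖ ≤ b)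
    (z : Fin t → X) (v : Fin t → ℝ) (hG : selfNormSq k (1 + 2 / n) z v ≤ G) {x₀ : X}
    (hx₀ : ∀ x, ucbAcquisition k' (1 + 2 / n) (b + √G) z ((fun i => ⟪φ (z i), g⟫_ℝ) + v) x ≤
      ucbAcquisition k' (1 + 2 / n) (b + √G) z ((fun i => ⟪φ (z i), g⟫_ℝ) + v) x₀) (x : X) :
    ⟪φ x, g⟫_ℝ - ⟪φ x₀, g⟫_ℝ ≤ 2 * (b + √G) * √(posteriorVar k (1 + 2 / n) z x₀) +
      12 * (1 + 2 * B) ^ 2 * (n * √e) * (b + √G) := by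
  have hn1 : (1 : ℝ) ≤ n := by exact_mod_cast hn
  have hn0 : (0 : ℝ) < n := by linarith
  have htn' : (t : ℝ) ≤ n := by exact_mod_cast htn
  have hs : (1 : ℝ) < 1 + 2 / n := by
    have : (0 : ℝ) < 2 / n := by positivity
    linarith
  set s : ℝ := 1 + 2 / n with hsdef
  set y : Fin t → ℝ := (fun i => ⟪φ (z i), g⟫_ℝ) + v with hy
  have hb0 : 0 ≤ b := (norm_nonneg _).trans hg
  have hG0 : 0 ≤ G := (selfNormSq_nonneg hk hs.le z v).trans hG
  set β := b + √G with hβ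
  have hβ0 : 0 ≤ β := by positivity
  set D := 1 + 2 * B with hD
  have hD1 : 1 ≤ D := by linarith
  have hDD : D ≤ D ^ 2 := by
    rw [sq]
    exact le_mul_of_one_le_left (by linarith) hD1
  have hnsq : (n : ℝ) ≤ (n : ℝ) ^ 2 := by nlinarith
  have hte : t * e ≤ 1 / 2 := by
    have h1 : (t : ℝ) * e ≤ (n : ℝ) ^ 2 * e := by gcongr; linarith
    linarith
  have hse : √e ^ 2 = e := Real.sq_sqrt he
  -- Allows the mean error, of order n²e = (n√e)², to be bounded by n√e, the order of the deviation
  -- error.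
  have hne1 : n * √e ≤ 1 := by
    refine abs_le_of_sq_le_sq' ?_ zero_le_one |>.2
    rw [mul_pow, hse]
    linarith
  have hne0 : 0 ≤ n * √e := by positivity
  have htB : 1 + 2 * (t * B) ≤ n * D := by
    have : (t : ℝ) * B ≤ n * B := by gcongr
    rw [hD]
    linarith
  -- Here s - 1 = 2/n makes the self-normalized square control the full norm of the noise, at the
  -- price of a factor of order n.
  have hv : v ⬝ᵥ v ≤ 2 * n * G := by
    have h1 := sub_one_mul_dotProduct_le_selfNormSq hk (by linarith : 0 < s) z v
    have h2 : s * selfNormSq k s z v ≤ s * G := by gcongr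
    have h3 : s - 1 = 2 / n := by rw [hsdef]; ring
    have h4 : 2 / n * (v ⬝ᵥ v) ≤ s * G := by rw [← h3]; linarith
    have h5 : s ≤ 3 := by
      have : (2 : ℝ) / n ≤ 2 := div_le_self (by norm_num) hn1
      linarith
    have h6 : 2 / n * (v ⬝ᵥ v) ≤ 4 * G := h4.trans (by gcongr; linarith)
    rw [div_mul_eq_mul_div, div_le_iff₀ hn0] at h6
    linarith
  have hyy : y ⬝ᵥ y ≤ n * (4 * D ^ 2 * β ^ 2) := by
    have h1 : y ⬝ᵥ y ≤ 2 * ∑ i, ⟪φ (z i), g⟫_ℝ ^ 2 + 2 * (v ⬝ᵥ v) := by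
      simp only [dotProduct]
      rw [Finset.mul_sum, Finset.mul_sum, ← Finset.sum_add_distrib]
      refine Finset.sum_le_sum fun i _ => ?_
      simp only [hy, Pi.add_apply]
      nlinarith [sq_nonneg (⟪φ (z i), g⟫_ℝ - v i)]
    have h2 : ∑ i, ⟪φ (z i), g⟫_ℝ ^ 2 ≤ t * (B * b ^ 2) := by
      have : ∀ i ∈ (Finset.univ : Finset (Fin t)), ⟪φ (z i), g⟫_ℝ ^ 2 ≤ B * b ^ 2 := by
        intro i _
        have h3 : ⟪φ (z i), g⟫_ℝ ^ 2 ≤ (‖φ (z i)‖ * ‖g‖) ^ 2 :=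
          sq_le_sq' (abs_le.mp (abs_real_inner_le_norm _ _)).1 (real_inner_le_norm _ _)
        have h4 : ‖φ (z i)‖ ^ 2 ≤ B := by
          rw [← real_inner_self_eq_norm_sq, ← hk]; exact hB _
        rw [mul_pow] at h3
        exact h3.trans (by gcongr)
      simpa using Finset.sum_le_card_nsmul _ _ _ this
    have h5 : (t : ℝ) * (B * b ^ 2) ≤ n * (B * b ^ 2) := by gcongr
    have h6 : b ^ 2 + G ≤ β ^ 2 := by
      rw [hβ, add_sq, Real.sq_sqrt hG0]
      have : 0 ≤ 2 * b * √G := by positivity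
      linarith
    have h7 : 2 * B * b ^ 2 + 4 * G ≤ 4 * D ^ 2 * β ^ 2 := by
      have h8 : 2 * B * b ^ 2 ≤ 4 * D ^ 2 * b ^ 2 := by
        have h9 : B * b ^ 2 ≤ D ^ 2 * b ^ 2 := by
          have : B ≤ D ^ 2 := by linarith
          gcongr
        have h10 : 0 ≤ D ^ 2 * b ^ 2 := by positivity
        linarith
      have h9 : 4 * G ≤ 4 * D ^ 2 * G := by
        have := le_mul_of_one_le_left hG0 (one_le_pow₀ (n := 2) hD1)
        linarith
      have h10 : 4 * D ^ 2 * (b ^ 2 + G) ≤ 4 * D ^ 2 * β ^ 2 := by gcongr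
      linarith
    have h11 := mul_le_mul_of_nonneg_left h7 hn0.le
    linarith
  have hsqrt : √(t * (y ⬝ᵥ y)) ≤ n * (2 * D * β) := by
    refine Real.sqrt_le_iff.mpr ⟨by positivity, ?_⟩
    calc (t : ℝ) * (y ⬝ᵥ y) ≤ n * (n * (4 * D ^ 2 * β ^ 2)) := by
          have := dotProduct_self_nonneg_real y
          gcongr
      _ = _ := by ring
  have hΔm : ∀ x, |posteriorMean k' s z y x - posteriorMean k s z y x| ≤
      4 * D ^ 2 * (n * √e) * β := fun x => by
    refine (abs_posteriorMean_sub_le hk hs.le he hB0 hB h hte z y x).trans ?_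
    calc _ ≤ e * (n * D) * (2 * (n * (2 * D * β))) := by gcongr
      _ = 4 * D ^ 2 * (n ^ 2 * e) * β := by ring
      _ = 4 * D ^ 2 * ((n * √e) * (n * √e)) * β := by rw [← sq, mul_pow, hse]
      _ ≤ 4 * D ^ 2 * ((n * √e) * 1) * β := by gcongr
      _ = _ := by ring
  have hΔv : ∀ x, |posteriorVar k' s z x - posteriorVar k s z x| ≤ (2 * D * (n * √e)) ^ 2 :=
    fun x => by
    refine (abs_posteriorVar_sub_le hk hs.le he hB0 hB h hte z x).trans ?_
    have h1 : 1 + 2 * (t * (B + e)) ≤ 2 * (n * D) := by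
      have : (1 : ℝ) ≤ n * D := by nlinarith
      nlinarith
    calc _ ≤ e * (n * D) * (2 * (n * D)) := by gcongr
      _ ≤ e * (n * D) * (4 * (n * D)) := by gcongr; norm_num
      _ = (2 * D * (n * √e)) ^ 2 := by
        rw [mul_pow, mul_pow (n : ℝ), hse]; ring
  have hacq : ∀ x, |ucbAcquisition k' s β z y x - ucbAcquisition k s β z y x| ≤
      6 * D ^ 2 * (n * √e) * β := fun x => by
    refine (abs_ucbAcquisition_sub_le hβ0 z y x (hΔm x) (hΔv x)).trans ?_
    rw [Real.sqrt_sq (by positivity)]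
    have : 2 * D * (n * √e) * β ≤ 2 * D ^ 2 * (n * √e) * β := by
      gcongr
    linarith
  -- Optimism: upper band at x, lower band at x₀, and the inexact maximization in between. The
  -- acquisition error is paid twice, whence 12 = 2 · 6.
  have hconf := fun x => abs_le.mp (abs_sub_posteriorMean_le hk hs z v x hg hG)
  have h1 := (hconf x).2
  have h2 := (hconf x₀).1
  have h3 := (abs_le.mp (hacq x)).1
  have h4 := (abs_le.mp (hacq x₀)).2
  have h5 := hx₀ x
  have h6 : ∀ x, ucbAcquisition k s β z y x =
    posteriorMean k s z y x + β * √(posteriorVar k s z x) := fun _ => rfl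
  rw [h6 x] at h3
  rw [h6 x₀] at h4
  linarith

end Acquisition

end

/-! ### Summing the regret -/

/-- Since γ' - ln δ ≥ c₀, the constants b and 1 are multiples of √(γ' - ln δ) and γ' - ln δ. -/
theorem ucbBeta_le {b σE σζ γ γ' δ c₀ : ℝ} (hb : 0 ≤ b) (hc₀ : 0 < c₀) (hγ : γ ≤ γ') (hγ' : c₀ ≤ γ')
    (hδ0 : 0 < δ) (hδ : δ < 1) :
    ucbBeta b σE σζ γ δ ≤
      (b / √c₀ + √(σE ^ 2 + σζ ^ 2) * √(2 * (1 + 1 / c₀))) * √(γ' - Real.log δ) := by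
  have hl : Real.log δ < 0 := Real.log_neg hδ0 hδ
  set Γ := γ' - Real.log δ with hΓ
  have hΓc : c₀ ≤ Γ := by linarith
  have h1 : b ≤ b / √c₀ * √Γ := by
    rw [div_mul_eq_mul_div, le_div_iff₀ (Real.sqrt_pos.mpr hc₀)]
    gcongr
  have h2 : √(2 * (γ + 1 - Real.log δ)) ≤ √(2 * (1 + 1 / c₀)) * √Γ := by
    rw [← Real.sqrt_mul (by positivity)]
    refine Real.sqrt_le_sqrt ?_
    have h3 : 1 ≤ 1 / c₀ * Γ := by
      rw [div_mul_eq_mul_div, one_mul, one_le_div hc₀]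
      exact hΓc
    have h4 : 2 * (1 + 1 / c₀) * Γ = 2 * Γ + 2 * (1 / c₀ * Γ) := by ring
    rw [h4]
    linarith
  rw [ucbBeta, add_mul, mul_assoc]
  gcongr

noncomputable section

section Regret

variable {X V : Type*} [NormedAddCommGroup V] [InnerProductSpace ℝ V] {k : X → X → ℝ}
  {φ : X → V}

/-- The log-determinant is t ln s plus twice the gain, and t ln(1 + 2/n) ≤ 2. The right-hand side is
exactly the square of the noise part of β. -/
theorem selfNormSq_le_of_log_det (hk : ∀ x y, k x y = ⟪φ x, φ y⟫_ℝ) {B : ℝ}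
    (hB : ∀ x, k x x ≤ B) {n t : ℕ} (hn : 1 ≤ n) (htn : t ≤ n) {z : Fin t → X} {v : Fin t → ℝ}
    {r δ : ℝ} (hr : 0 ≤ r)
    (h : selfNormSq k (1 + 2 / n) z v ≤
      r * (Real.log (regGram k (1 + 2 / n) z).det - 2 * Real.log δ)) :
    selfNormSq k (1 + 2 / n) z v ≤
      r * (2 * (maxInfoGain k (1 + 2 / n) t + 1 - Real.log δ)) := by
  have hn0 : (0 : ℝ) < n := by exact_mod_cast hn
  have hs : (0 : ℝ) < 1 + 2 / n := by positivity
  refine h.trans (mul_le_mul_of_nonneg_left ?_ hr)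
  have h1 := infoGain_le_maxInfoGain hk hs hB z
  have h2 : (t : ℝ) * Real.log (1 + 2 / n) ≤ 2 := by
    have h3 := Real.log_le_sub_one_of_pos hs
    calc (t : ℝ) * Real.log (1 + 2 / n) ≤ n * (1 + 2 / n - 1) := by
          have : (t : ℝ) ≤ n := by exact_mod_cast htn
          have : 0 ≤ Real.log (1 + 2 / (n : ℝ)) :=
            Real.log_nonneg (by have : (0 : ℝ) < 2 / n := by positivity
                                linarith)
          gcongr
      _ = 2 := by field_simp; ring
  rw [log_det_regGram hk hs]
  linarith

theorem sum_sqrt_posteriorVar_le (hk : ∀ x y, k x y = ⟪φ x, φ y⟫_ℝ) {B s : ℝ} (hs : 1 ≤ s)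
    (hB : ∀ x, k x x ≤ B) (x : ℕ → X) (n : ℕ) :
    ∑ t ∈ Finset.range n, √(posteriorVar k s (fun i : Fin t => x i) (x t)) ≤
      √(n * (2 * (s * (1 + B)) * maxInfoGain k s n)) := by
  refine Real.le_sqrt_of_sq_le ?_
  refine (sq_sum_le_card_mul_sum_sq).trans ?_
  rw [Finset.card_range]
  refine mul_le_mul_of_nonneg_left ?_ (Nat.cast_nonneg n)
  refine le_of_eq_of_le (Finset.sum_congr rfl fun t _ => ?_) (sum_posteriorVar_le hk hs hB x n)
  rw [Real.sq_sqrt (posteriorVar_nonneg hk (by linarith) _ _)]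

/-- The constant of the regret bound. -/
def regretConst (b σE σζ κ B : ℝ) : ℝ :=
  (2 * √(6 * (1 + B)) + 12 * (1 + 2 * B) ^ 2) *
      (b / √(1 / 2 * Real.log (1 + κ / 3)) +
        √(σE ^ 2 + σζ ^ 2) * √(2 * (1 + 1 / (1 / 2 * Real.log (1 + κ / 3))))) +
    4 * (b * (1 + B)) + 1

/-- The deterministic regret bound on the event of accurate kernel estimates and
self-normalized noise. -/
theorem sum_regret_le (hk : ∀ x y, k x y = ⟪φ x, φ y⟫_ℝ) {b σE σζ κ B δ e : ℝ}
    (hκ : 0 < κ) (hB : ∀ x, k x x ≤ B) (hκx : ∃ x, κ ≤ k x x) {g : V} (hg : ‖g‖ ≤ b)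
    (hδ0 : 0 < δ) (hδ : δ < 1) (he : 0 ≤ e) {n : ℕ} (hn : 1 ≤ n)
    {k' : ℕ → X → X → ℝ} (hk' : ∀ t < n, ∀ x y, |k x y - k' t x y| ≤ e)
    {x : ℕ → X} {v : ℕ → ℝ}
    (hv : ∀ t < n, selfNormSq k (1 + 2 / n) (fun i : Fin t => x i) (fun i : Fin t => v i) ≤
      (σE ^ 2 + σζ ^ 2) *
        (Real.log (regGram k (1 + 2 / n) (fun i : Fin t => x i)).det - 2 * Real.log δ))
    (hx : ∀ t < n, ∀ x', ucbAcquisition (k' t) (1 + 2 / n)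
        (ucbBeta b σE σζ (maxInfoGain k (1 + 2 / n) t) δ) (fun i : Fin t => x i)
        (fun i : Fin t => ⟪φ (x i), g⟫_ℝ + v i) x' ≤
      ucbAcquisition (k' t) (1 + 2 / n)
        (ucbBeta b σE σζ (maxInfoGain k (1 + 2 / n) t) δ) (fun i : Fin t => x i)
        (fun i : Fin t => ⟪φ (x i), g⟫_ℝ + v i) (x t)) :
    ∑ t ∈ Finset.range n, ((⨆ z, ⟪φ z, g⟫_ℝ) - ⟪φ (x t), g⟫_ℝ) ≤
      regretConst b σE σζ κ B *
        (√(n * maxInfoGain k (1 + 2 / n) n * (maxInfoGain k (1 + 2 / n) n - Real.log δ)) +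
          n ^ 2 * √((maxInfoGain k (1 + 2 / n) n - Real.log δ) * e) + n ^ 3 * e) := by
  obtain ⟨x₁, hx₁⟩ := hκx
  have hne : Nonempty X := ⟨x₁⟩
  have hB0 : 0 ≤ B := hκ.le.trans (hx₁.trans (hB x₁))
  have hb0 : 0 ≤ b := (norm_nonneg _).trans hg
  have hn1 : (1 : ℝ) ≤ n := by exact_mod_cast hn
  have hn0 : (0 : ℝ) < n := by linarith
  have hs2 : (2 : ℝ) / n ≤ 2 := div_le_self (by norm_num) hn1
  have hs0 : (0 : ℝ) < 2 / n := by positivity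
  set s : ℝ := 1 + 2 / n with hs
  have hs1 : 1 ≤ s := by linarith
  -- The 3 bounds s = 1 + 2/n for n ≥ 1, which makes `c₀` independent of n.
  set c₀ := 1 / 2 * Real.log (1 + κ / 3) with hc₀
  have hc₀pos : 0 < c₀ := mul_pos (by norm_num) (Real.log_pos (by
    have : 0 < κ / 3 := by positivity
    linarith))
  set γ := maxInfoGain k s n with hγ
  have hcγ : c₀ ≤ γ := by
    refine le_trans ?_ (le_maxInfoGain_of_le hk (by linarith) hκ hB hx₁ hn)
    rw [hc₀]
    have : κ / 3 ≤ κ / s := by gcongr; linarith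
    have : 0 < κ / 3 := by positivity
    gcongr
  have hγ0 : 0 < γ := by linarith
  set Γ := γ - Real.log δ with hΓ
  have hΓ0 : 0 < Γ := by linarith [Real.log_neg hδ0 hδ]
  set C₁ := b / √c₀ + √(σE ^ 2 + σζ ^ 2) * √(2 * (1 + 1 / c₀)) with hC₁
  have hC₁0 : 0 ≤ C₁ := by positivity
  have hrC : regretConst b σE σζ κ B =
    (2 * √(6 * (1 + B)) + 12 * (1 + 2 * B) ^ 2) * C₁ + 4 * (b * (1 + B)) + 1 := rfl
  -- For large error coercivity may fail, but then n < 2n³e and the trivial bound 2b(1 + B) per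
  -- round suffices.
  rcases lt_or_ge (1 / 2) ((n : ℝ) ^ 2 * e) with hlarge | hsmall
  · have hbd : ∀ y, |⟪φ y, g⟫_ℝ| ≤ b * (1 + B) := fun y => by
      have h1 : ‖φ y‖ ^ 2 ≤ B := by rw [← real_inner_self_eq_norm_sq, ← hk]; exact hB y
      have h2 : ‖φ y‖ ≤ 1 + B := by nlinarith [norm_nonneg (φ y)]
      refine (abs_real_inner_le_norm _ _).trans ?_
      rw [mul_comm]
      gcongr
    have h1 : ∑ t ∈ Finset.range n, ((⨆ z, ⟪φ z, g⟫_ℝ) - ⟪φ (x t), g⟫_ℝ) ≤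
        n * (2 * (b * (1 + B))) := by
      have h2 : ∀ t ∈ Finset.range n, (⨆ z, ⟪φ z, g⟫_ℝ) - ⟪φ (x t), g⟫_ℝ ≤ 2 * (b * (1 + B)) := by
        intro t _
        have h3 : (⨆ z, ⟪φ z, g⟫_ℝ) ≤ b * (1 + B) := ciSup_le fun z => (abs_le.mp (hbd z)).2
        linarith [(abs_le.mp (hbd (x t))).1]
      simpa using Finset.sum_le_card_nsmul _ _ _ h2
    refine h1.trans ?_
    have h4 : (n : ℝ) ≤ 2 * (n ^ 3 * e) := by
      have := mul_le_mul_of_nonneg_left hlarge.le hn0.le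
      linarith
    calc n * (2 * (b * (1 + B))) ≤ 2 * (n ^ 3 * e) * (2 * (b * (1 + B))) := by gcongr
      _ = 4 * (b * (1 + B)) * (n ^ 3 * e) := by ring
      _ ≤ regretConst b σE σζ κ B * (n ^ 3 * e) := by
          have : 0 ≤ (2 * √(6 * (1 + B)) + 12 * (1 + 2 * B) ^ 2) * C₁ := by positivity
          rw [hrC]
          gcongr
          linarith
      _ ≤ _ := by
          have : 0 ≤ regretConst b σE σζ κ B := by rw [hrC]; positivity
          gcongr
          have : 0 ≤ √(n * γ * Γ) + n ^ 2 * √(Γ * e) := by positivity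
          linarith
  · set β := C₁ * √Γ with hβ
    have hβ0 : 0 ≤ β := by positivity
    have hround : ∀ t ∈ Finset.range n, (⨆ z, ⟪φ z, g⟫_ℝ) - ⟪φ (x t), g⟫_ℝ ≤
        2 * β * √(posteriorVar k s (fun i : Fin t => x i) (x t)) +
          12 * (1 + 2 * B) ^ 2 * (n * √e) * β := by
      intro t ht
      have htn : t < n := Finset.mem_range.mp ht
      rw [sub_le_iff_le_add]
      refine ciSup_le fun z => ?_
      rw [← sub_le_iff_le_add]
      have hG := selfNormSq_le_of_log_det hk hB hn htn.le (by positivity) (hv t htn)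
      have hβt : ucbBeta b σE σζ (maxInfoGain k s t) δ =
          b + √((σE ^ 2 + σζ ^ 2) * (2 * (maxInfoGain k s t + 1 - Real.log δ))) := by
        rw [ucbBeta, Real.sqrt_mul (by positivity : 0 ≤ σE ^ 2 + σζ ^ 2)]
      have hxt := hx t htn
      have hle := ucbBeta_le (σE := σE) (σζ := σζ) hb0 hc₀pos
        (maxInfoGain_mono hk (by linarith) hB htn.le) hcγ hδ0 hδ
      rw [hβt] at hxt hle
      refine (inner_sub_inner_le_of_ucb_maximizer hk he hB0 hB (hk' t htn) hn htn.le hsmall hg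
        (fun i : Fin t => x i) (fun i : Fin t => v i) hG hxt z).trans ?_
      gcongr
    refine (Finset.sum_le_sum hround).trans ?_
    rw [Finset.sum_add_distrib, ← Finset.mul_sum, Finset.sum_const, Finset.card_range,
      nsmul_eq_mul]
    have h1 : ∑ t ∈ Finset.range n, √(posteriorVar k s (fun i : Fin t => x i) (x t)) ≤
        √(6 * (1 + B)) * √(n * γ) := by
      refine (sum_sqrt_posteriorVar_le hk hs1 hB x n).trans ?_
      rw [← Real.sqrt_mul (by positivity)]
      refine Real.sqrt_le_sqrt ?_
      have h2 : n * (2 * (s * (1 + B)) * γ) ≤ n * (2 * (3 * (1 + B)) * γ) := by gcongr; linarith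
      refine h2.trans (le_of_eq (by ring))
    calc 2 * β * ∑ t ∈ Finset.range n, √(posteriorVar k s (fun i : Fin t => x i) (x t)) +
          n * (12 * (1 + 2 * B) ^ 2 * (n * √e) * β)
        ≤ 2 * β * (√(6 * (1 + B)) * √(n * γ)) + n * (12 * (1 + 2 * B) ^ 2 * (n * √e) * β) := by
          gcongr
      _ = 2 * √(6 * (1 + B)) * C₁ * √(n * γ * Γ) +
          12 * (1 + 2 * B) ^ 2 * C₁ * (n ^ 2 * √(Γ * e)) := by
          rw [Real.sqrt_mul (by positivity) Γ, Real.sqrt_mul hΓ0.le e, hβ]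
          ring
      _ ≤ regretConst b σE σζ κ B * √(n * γ * Γ) +
          regretConst b σE σζ κ B * (n ^ 2 * √(Γ * e)) + regretConst b σE σζ κ B * (n ^ 3 * e) := by
          have p1 : 0 ≤ 2 * √(6 * (1 + B)) * C₁ := by positivity
          have p2 : 0 ≤ 12 * (1 + 2 * B) ^ 2 * C₁ := by positivity
          have p3 : 0 ≤ 4 * (b * (1 + B)) := by positivity
          have q1 : 2 * √(6 * (1 + B)) * C₁ ≤ regretConst b σE σζ κ B := by rw [hrC]; linarith
          have q2 : 12 * (1 + 2 * B) ^ 2 * C₁ ≤ regretConst b σE σζ κ B := by rw [hrC]; linarith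
          have q3 : 0 ≤ regretConst b σE σζ κ B * (n ^ 3 * e) :=
            mul_nonneg (p1.trans q1) (by positivity)
          refine le_add_of_le_of_nonneg ?_ q3
          gcongr
      _ = _ := by ring

end Regret

end

/-! ### Feature map of the RKHS and the main theorem -/

theorem reproducingKernel_eq_inner {H X : Type*} [NormedAddCommGroup H] [InnerProductSpace ℝ H]
    [CompleteSpace H] [RKHS ℝ H X ℝ] (x y : X) :
    reproducingKernel H x y = ⟪RKHS.kerFun H x (1 : ℝ), RKHS.kerFun H y (1 : ℝ)⟫_ℝ := by
  have h := RKHS.kernel_inner (𝕜 := ℝ) H x y (1 : ℝ) (1 : ℝ)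
  rw [real_inner_comm, ← h, reproducingKernel]
  simp

theorem apply_eq_inner_kerFun {H X : Type*} [NormedAddCommGroup H] [InnerProductSpace ℝ H]
    [CompleteSpace H] [RKHS ℝ H X ℝ] (x : X) (g : H) :
    g x = ⟪RKHS.kerFun H x (1 : ℝ), g⟫_ℝ := by
  rw [RKHS.kerFun_inner]
  simp

theorem theorem1 (b σE σζ κ B : ℝ) (hσE : 0 < σE) (hσζ : 0 < σζ) (hκ : 0 < κ) :
    ∃ C : ℝ, 0 < C ∧
      -- the query domain, the class of distributions and the uncertain inputs
      ∀ (d : ℕ) (𝒳 : Set (Euc d)) (𝒬 : Set (Measure (Euc d))) (P : Kernel 𝒳 (Euc d))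
        (hP : ∀ x, P x ∈ 𝒬),
      (∀ Q ∈ 𝒬, IsProbabilityMeasure Q) →
      -- the space `H_k` with its mean map, and the objective `f ∈ H_k`
      ∀ (H : Type*) [NormedAddCommGroup H] [InnerProductSpace ℝ H] [CompleteSpace H]
        [RKHS ℝ H (Euc d) ℝ] (ψ : 𝒬 → H) (f : H),
      (∀ g : H, Measurable fun v => g v) →
      IsMeanMap 𝒬 ψ →
      InputNoiseSubGaussian P (fun v => f v) σE →
      -- the space of functions on `𝒬` with kernel `k̂(Q, Q') = L (ψ Q) (ψ Q')`
      ∀ (Hhat : Type*) [NormedAddCommGroup Hhat] [InnerProductSpace ℝ Hhat] [CompleteSpace Hhat]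
        [RKHS ℝ Hhat 𝒬 ℝ] (L : H → H → ℝ) (fhat : Hhat),
      (∀ Q Q' : 𝒬, reproducingKernel Hhat Q Q' = L (ψ Q) (ψ Q')) →
      (Measurable fun p : 𝒳 × 𝒳 => inputKernel L ψ P hP p.1 p.2) →
      (∃ x, κ ≤ inputKernel L ψ P hP x x) →
      (∀ x, inputKernel L ψ P hP x x ≤ B) →
      (∀ Q : 𝒬, fhat Q = ∫ v, f v ∂Q.1) →
      ‖fhat‖ ≤ b →
      -- the process, run for `n` rounds with estimated kernels
      ∀ (n : ℕ) (δ ε e : ℝ), 1 ≤ n → 0 < δ → 0 < ε → 0 ≤ e →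
      ∀ (Ω : Type*) [mΩ : MeasurableSpace Ω] (μ : Measure Ω) [IsProbabilityMeasure μ]
        (ℱ : Filtration ℕ mΩ) (x : ℕ → Ω → 𝒳) (u : ℕ → Ω → Euc d) (ζ : ℕ → Ω → ℝ)
        (ktil : ℕ → Ω → 𝒳 → 𝒳 → ℝ),
      IsUncertainInputProcess μ ℱ n P σζ x u ζ →
      IsKernelEstimate μ n (inputKernel L ψ P hP) ktil e ε →
      IsInexactGPUCB μ n ktil (1 + 2 / n)
        (fun t => ucbBeta b σE σζ (maxInfoGain (inputKernel L ψ P hP) (1 + 2 / n) t) δ)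
        (fun v => f v) x u ζ →
      1 - δ - n * ε ≤ μ.real {ω |
        cumulativeRegret P (fun v => f v) n (fun t => x t ω) ≤
          C * (√(n * maxInfoGain (inputKernel L ψ P hP) (1 + 2 / n) n *
                  (maxInfoGain (inputKernel L ψ P hP) (1 + 2 / n) n - Real.log δ))
            + n ^ 2 * √((maxInfoGain (inputKernel L ψ P hP) (1 + 2 / n) n - Real.log δ) * e)
            + n ^ 3 * e)} := by
  -- The constant is chosen before any setting is given. If b < 0 or B < κ no setting exists and any
  -- positive constant works.
  by_cases hbB : 0 ≤ b ∧ κ ≤ B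
  swap
  · refine ⟨1, one_pos, ?_⟩
    intro d 𝒳 𝒬 P hP h𝒬 H _ _ _ _ ψ f hfm hψ hE Hhat _ _ _ _ L fhat hL hLm hκx hBx hfhat hfb
    obtain ⟨x₁, hx₁⟩ := hκx
    exact absurd ⟨(norm_nonneg _).trans hfb, hx₁.trans (hBx x₁)⟩ hbB
  obtain ⟨hb, hκB⟩ := hbB
  have hB0 : 0 ≤ B := hκ.le.trans hκB
  have hlog : 0 ≤ Real.log (1 + κ / 3) := Real.log_nonneg (by
    have : 0 < κ / 3 := by positivity
    linarith)
  refine ⟨regretConst b σE σζ κ B, by rw [regretConst]; positivity, ?_⟩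
  intro d 𝒳 𝒬 P hP h𝒬 H _ _ _ _ ψ f hfm hψ hE Hhat _ _ _ _ L fhat hL hLm hκx hBx hfhat hfb
    n δ ε e hn hδ hε he Ω mΩ μ hμ ℱ x u ζ ktil hp hest hucb
  -- For δ ≥ 1 the claimed probability is at most 0; otherwise ln δ < 0, as the deterministic bound
  -- requires.
  rcases le_or_gt 1 δ with hδ1 | hδ1
  · have h1 : 0 ≤ n * ε := by positivity
    exact le_trans (by linarith) measureReal_nonneg
  have hMarkov : IsMarkovKernel P := ⟨fun x => h𝒬 _ (hP x)⟩
  set φ : 𝒳 → Hhat := fun x => RKHS.kerFun Hhat (⟨P x, hP x⟩ : 𝒬) (1 : ℝ) with hφ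
  have hk : ∀ x y, inputKernel L ψ P hP x y = ⟪φ x, φ y⟫_ℝ := fun x y => by
    rw [inputKernel, ← hL, reproducingKernel_eq_inner]
  -- The reproducing property makes the expected objective linear in the features.
  have hmean : ∀ x, ∫ v, f v ∂(P x) = ⟪φ x, fhat⟫_ℝ := fun x => by
    rw [hφ, ← apply_eq_inner_kerFun, hfhat]
  set k := inputKernel L ψ P hP with hkdef
  have hn0 : (0 : ℝ) < n := by exact_mod_cast hn
  have hs : (1 : ℝ) < 1 + 2 / n := by
    have : (0 : ℝ) < 2 / n := by positivity
    linarith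
  have hnoise := measure_exists_selfNormSq_gt_le hk hs hLm hp (hfm f) hE (by positivity) hδ
  set N := {ω | ∃ t ≤ n, (σE ^ 2 + σζ ^ 2) *
        (Real.log (regGram k (1 + 2 / n) (fun i : Fin t => x i ω)).det - 2 * Real.log δ) <
        selfNormSq k (1 + 2 / n) (fun i : Fin t => x i ω)
          (fun i : Fin t => f (u i ω) + ζ i ω - ∫ v, f v ∂(P (x i ω)))} with hN
  set S := {ω | cumulativeRegret P (fun v => f v) n (fun t => x t ω) ≤
      regretConst b σE σζ κ B * (√(n * maxInfoGain k (1 + 2 / n) n *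
        (maxInfoGain k (1 + 2 / n) n - Real.log δ)) +
        n ^ 2 * √((maxInfoGain k (1 + 2 / n) n - Real.log δ) * e) + n ^ 3 * e)} with hS
  have hgood : ∀ᵐ ω ∂μ, ω ∈ S ∪ (N ∪ ⋃ t ∈ Finset.range n,
      {ω | ¬ ∀ x y, |k x y - ktil t ω x y| ≤ e}) := by
    filter_upwards [hucb] with ω hω
    by_contra hnot
    simp only [Set.mem_union, Set.mem_iUnion, not_or, not_exists] at hnot
    obtain ⟨hnS, hnN, hnE⟩ := hnot
    have hest' : ∀ t < n, ∀ x y, |k x y - ktil t ω x y| ≤ e := fun t ht =>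
      not_not.mp (hnE t (Finset.mem_range.mpr ht))
    have hv : ∀ t < n, selfNormSq k (1 + 2 / n) (fun i : Fin t => x i ω)
        (fun i : Fin t => f (u i ω) + ζ i ω - ∫ v, f v ∂(P (x i ω))) ≤ (σE ^ 2 + σζ ^ 2) *
        (Real.log (regGram k (1 + 2 / n) (fun i : Fin t => x i ω)).det - 2 * Real.log δ) :=
      fun t ht => not_lt.mp fun h => hnN ⟨t, ht.le, h⟩
    refine hnS ?_
    have hobs : ∀ i, f (u i ω) + ζ i ω = ⟪φ (x i ω), fhat⟫_ℝ +
        (f (u i ω) + ζ i ω - ∫ v, f v ∂(P (x i ω))) := fun i => by rw [← hmean]; ring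
    have hreg := sum_regret_le (x := fun t => x t ω) (k' := fun t => ktil t ω)
      (v := fun i => f (u i ω) + ζ i ω - ∫ v, f v ∂(P (x i ω)))
      hk hκ hBx hκx hfb hδ hδ1 he hn hest' hv (fun t ht x' => by
        simp only [← hobs]
        exact hω t ht x')
    simp only [← hmean] at hreg
    exact hreg
  have hbad : μ (⋃ t ∈ Finset.range n, {ω | ¬ ∀ x y, |k x y - ktil t ω x y| ≤ e}) ≤
      ENNReal.ofReal (n * ε) := by
    refine (measure_biUnion_finset_le _ _).trans ?_
    refine (Finset.sum_le_card_nsmul _ _ _ fun t ht => hest t (Finset.mem_range.mp ht)).trans ?_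
    rw [Finset.card_range, nsmul_eq_mul, ENNReal.ofReal_mul (Nat.cast_nonneg n),
      ENNReal.ofReal_natCast]
  -- Only subadditivity of the outer measure is used, so neither the regret event nor the
  -- kernel-error events have to be measurable.
  have htotal : (1 : ENNReal) ≤ μ S + ENNReal.ofReal (δ + n * ε) := by
    rw [← measure_univ (μ := μ), ENNReal.ofReal_add hδ.le (by positivity)]
    refine (measure_mono_ae (hgood.mono fun ω h _ => h)).trans ?_
    refine (measure_union_le _ _).trans ?_
    gcongr
    exact (measure_union_le _ _).trans (add_le_add hnoise hbad)
  have hreal := ENNReal.toReal_mono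
    (ENNReal.add_ne_top.mpr ⟨measure_ne_top μ S, ENNReal.ofReal_ne_top⟩) htotal
  rw [ENNReal.toReal_add (measure_ne_top μ S) ENNReal.ofReal_ne_top,
    ENNReal.toReal_ofReal (by positivity), ENNReal.toReal_one] at hreal
  change _ ≤ (μ S).toReal
  linarith
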